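/- Let $(\epsilon_j)_{j\ge 1}$ be pairwise distinct numbers in $(0,1)$ with $\sum_j\epsilon_j<\infty$ (for example $\epsilon_j=2^{-j}$), and put $a_j=1-\epsilon_j$. If the positive numbers $c_j$ decay sufficiently fast, i.e. there are $\delta_j>0$ depending only on $(\epsilon_j)$ such that the following holds whenever $0<c_j\le\delta_j$ for all $j$, then $\sum_j c_j/\epsilon_j<\infty$, and with $$\omega(\zeta)=\sum_{j}\frac{c_j}{\zeta-a_j}+\sum_j\frac{c_j}{a_j}$$ the following is true. Regard $\mathbf C^2$ as a subset of $\mathbf P^2$ through $(z,w)\mapsto[1:z:w]$. Let $\gamma_0=\{(\zeta,\omega(\zeta)):|\zeta|=1\}\subset\mathbf C^2$, let $L\subset\mathbf P^2$ be the projective line given by $z=1$, let $\ell=[0:0:1]\in L$ be the point at infinity of the vertical lines, let $p=(1,\omega(1))\in L$, and let $W$ be the closure in $\mathbf P^2\setminus L$ of the graph of $\omega$ over $\mathbf C\setminus(\{1\}\cup\{a_j\}_j)$. Then: 1. $\omega$ is continuous on the unit circle, so that $\gamma_0$ is a simple closed curve, and $\gamma_0$ is real analytic (a real analytic one-dimensional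 submanifold of $\mathbf C^2$) near each of its points except $p$, where it is not. 2. $W$ is a complex analytic subvariety of $\mathbf P^2\setminus L$ of pure dimension one, and it is not algebraic: it is not the intersection of an algebraic subset of $\mathbf P^2$ with $\mathbf P^2\setminus L$. 3. $$\widehat{\gamma_0}=W\cup\{\ell,p\}\qquad\text{and}\qquad\overline{\widehat{\gamma_0}}=W\cup L .$$ Here the projective hull $\widehat K$ of a compact set $K\subset\mathbf P^2$ is the set of all $x\in\mathbf P^2$ for which there is a constant $C>0$ with $\|P(x)\|\le C^d\sup_K\|P\|$ for all $d\ge 0$ and all $P\in H^0(\mathbf P^2,\mathcal O(d))$, that is, all homogeneous polynomials $P$ of degree $d$, with $\|P([v])\|=|P(v)|/\|v\|^d$. -/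

import Mathlib

open scoped LinearAlgebra.Projectivization Topology
open Filter

namespace ProjHull

/-! ### The complex projective plane -/

/-- `ℂ³` with its standard Hermitian norm. -/
abbrev C3 := EuclideanSpace ℂ (Fin 3)

/-- The complex projective plane, with homogeneous coordinates `[t : z : w]`. -/
abbrev P2 := ℙ ℂ C3

/-- The quotient topology from `ℂ³ ∖ {0}`. -/
noncomputable instance : TopologicalSpace P2 :=
  TopologicalSpace.coinduced (fun v : {v : C3 // v ≠ 0} => Projectivization.mk ℂ v.1 v.2)
    inferInstance

theorem affine_ne_zero (z w : ℂ) : (!₂[1, z, w] : C3) ≠ 0 := by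
  intro h
  have := congrArg (fun v : C3 => v 0) h
  simp at this

theorem vertical_ne_zero : (!₂[0, 0, 1] : C3) ≠ 0 := by
  intro h
  have := congrArg (fun v : C3 => v 2) h
  simp at this

/-- The standard affine chart `ℂ² ⊂ P²`, `(z, w) ↦ [1 : z : w]`. -/
noncomputable def affine (q : ℂ × ℂ) : P2 :=
  Projectivization.mk ℂ !₂[1, q.1, q.2] (affine_ne_zero q.1 q.2)

/-- The point `ℓ = [0 : 0 : 1]` at infinity of the vertical lines `z = const`. -/
noncomputable def ell : P2 := Projectivization.mk ℂ !₂[0, 0, 1] vertical_ne_zero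

/-- The projective line `L` determined by the equation `z = 1`, that is, by `z = t` in
homogeneous coordinates (the condition does not depend on the representative). -/
def lineL : Set P2 := {x | x.rep 1 = x.rep 0}

theorem mk_mem_lineL (v : C3) (hv : v ≠ 0) :
    Projectivization.mk ℂ v hv ∈ lineL ↔ v 1 = v 0 := by
  obtain ⟨a, ha⟩ := Projectivization.exists_smul_eq_mk_rep ℂ v hv
  simp only [lineL, Set.mem_ofPred_eq, ← ha]
  simp [Units.smul_def]

/-! ### The projective hull -/

/-- The pointwise norm `‖P(x)‖` of the section of `𝒪(d)` given by a homogeneous polynomial `P` of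
degree `d`, in the standard metric: `‖P([v])‖ = |P(v)| / ‖v‖ ^ d`. -/
noncomputable def sectionNorm (d : ℕ) (P : MvPolynomial (Fin 3) ℂ) (x : P2) : ℝ :=
  ‖MvPolynomial.eval (fun i => x.rep i) P‖ / ‖x.rep‖ ^ d

/-- The norm of a section may be computed with any representative. -/
theorem sectionNorm_mk {d : ℕ} {P : MvPolynomial (Fin 3) ℂ} (hP : P.IsHomogeneous d)
    (v : C3) (hv : v ≠ 0) :
    sectionNorm d P (Projectivization.mk ℂ v hv)
      = ‖MvPolynomial.eval (fun i => v i) P‖ / ‖v‖ ^ d := by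
  obtain ⟨a, ha⟩ := Projectivization.exists_smul_eq_mk_rep ℂ v hv
  unfold sectionNorm
  rw [← ha]
  have h1 : MvPolynomial.eval (fun i => (a • v : C3) i) P
      = (a : ℂ) ^ d * MvPolynomial.eval (fun i => v i) P := by
    have : (fun i => (a • v : C3) i) = (a : ℂ) • (fun i => v i) := by
      funext i
      simp [Units.smul_def]
    rw [this, MvPolynomial.eval_eq', MvPolynomial.eval_eq', Finset.mul_sum]
    refine Finset.sum_congr rfl fun m hm => ?_
    have hd : ∑ i, m i = d := by
      have := hP (MvPolynomial.mem_support_iff.mp hm)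
      rw [← this, Finsupp.weight_apply, Finsupp.sum_fintype _ _ (by simp)]
      simp
    simp only [Pi.smul_apply, smul_eq_mul, mul_pow, Finset.prod_mul_distrib,
      Finset.prod_pow_eq_pow_sum, hd]
    ring
  have h2 : ‖(a • v : C3)‖ = ‖(a : ℂ)‖ * ‖v‖ := by
    rw [Units.smul_def, norm_smul]
  rw [h1, h2, norm_mul, norm_pow, mul_pow]
  have ha0 : ‖(a : ℂ)‖ ^ d ≠ 0 := pow_ne_zero _ (norm_ne_zero_iff.mpr a.ne_zero)
  rw [mul_div_mul_left _ _ ha0]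

/-- The projective hull of a compact set `K ⊆ P²`: all points `x` for which there is a constant
`C > 0` with `‖P(x)‖ ≤ C ^ d * sup_K ‖P‖` for all `d` and all `P ∈ H⁰(P², 𝒪(d))`. The supremum
is expressed through its upper bounds `M`. -/
def projHull (K : Set P2) : Set P2 :=
  {x | ∃ C : ℝ, 0 < C ∧ ∀ (d : ℕ) (P : MvPolynomial (Fin 3) ℂ), P.IsHomogeneous d →
    ∀ M : ℝ, (∀ y ∈ K, sectionNorm d P y ≤ M) → sectionNorm d P x ≤ C ^ d * M}

/-! ### Analytic and algebraic subsets -/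

open Classical in
/-- `f` is holomorphic on the open set `U ⊆ P²`: its pullback to the cone over `U` in
`ℂ³ ∖ {0}` is holomorphic. -/
def HolomorphicOn (f : P2 → ℂ) (U : Set P2) : Prop :=
  DifferentiableOn ℂ (fun v : C3 => if h : v ≠ 0 then f (Projectivization.mk ℂ v h) else 0)
    {v | ∃ h : v ≠ 0, Projectivization.mk ℂ v h ∈ U}

/-- `A` is a complex analytic subvariety of the open set `Ω ⊆ P²`: near each point of `Ω`
it is the common zero set of finitely many holomorphic functions. -/
def IsAnalyticSubvariety (A Ω : Set P2) : Prop :=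
  A ⊆ Ω ∧ ∀ x ∈ Ω, ∃ U : Set P2, IsOpen U ∧ x ∈ U ∧ U ⊆ Ω ∧
    ∃ (m : ℕ) (f : Fin m → P2 → ℂ), (∀ i, HolomorphicOn (f i) U) ∧
      A ∩ U = {y | y ∈ U ∧ ∀ i, f i y = 0}

/-- Near `x`, the set `A` is a one-dimensional complex submanifold of `P²`: some holomorphic
immersion `φ` of a neighbourhood of `0 ∈ ℂ`, given in homogeneous coordinates by `ψ`, maps the
neighbourhoods of `0` onto the neighbourhoods of `x` in `A`. -/
def IsComplexCurveAt (A : Set P2) (x : P2) : Prop :=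
  ∃ (φ : ℂ → P2) (ψ : ℂ → C3), AnalyticAt ℂ ψ 0 ∧
    LinearIndependent ℂ ![ψ 0, deriv ψ 0] ∧
    (∀ᶠ s in 𝓝 (0 : ℂ), ∃ h : ψ s ≠ 0, φ s = Projectivization.mk ℂ (ψ s) h) ∧
    φ 0 = x ∧ map φ (𝓝 0) = 𝓝[A] x

/-- For an analytic set `A`: it is non-empty and of pure dimension one, that is, the points near
which it is a one-dimensional complex submanifold are dense in it. -/
def HasPureDimensionOne (A : Set P2) : Prop :=
  A.Nonempty ∧ A ⊆ closure {x | x ∈ A ∧ IsComplexCurveAt A x}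

/-- `A` is an algebraic subset of `Ω ⊆ P²`: the set of common zeros in `Ω` of some homogeneous
polynomials. -/
def IsAlgebraicIn (A Ω : Set P2) : Prop :=
  ∃ S : Set (MvPolynomial (Fin 3) ℂ), (∀ P ∈ S, ∃ d : ℕ, P.IsHomogeneous d) ∧
    A = {x | x ∈ Ω ∧ ∀ P ∈ S, MvPolynomial.eval (fun i => x.rep i) P = 0}

/-- Near `q`, the set `γ ⊆ ℂ²` is a real analytic curve (a one-dimensional real analytic
submanifold): some real analytic immersion of a neighbourhood of `0 ∈ ℝ` maps the neighbourhoods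
of `0` onto the neighbourhoods of `q` in `γ`. -/
def IsRealAnalyticCurveAt (γ : Set (ℂ × ℂ)) (q : ℂ × ℂ) : Prop :=
  ∃ φ : ℝ → ℂ × ℂ, AnalyticAt ℝ φ 0 ∧ deriv φ 0 ≠ 0 ∧ φ 0 = q ∧ map φ (𝓝 0) = 𝓝[γ] q

/-! ### The example -/

/-- The pole `a_j = 1 - ε_j`. -/
noncomputable def pole (ε : ℕ → ℝ) (j : ℕ) : ℂ := ((1 - ε j : ℝ) : ℂ)

/-- `ω(ζ) = ∑ c_j / (ζ - a_j) + ∑ c_j / a_j` (meaningful where `ζ` is not one of the `a_j`). -/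
noncomputable def omega (ε c : ℕ → ℝ) (ζ : ℂ) : ℂ :=
  ∑' j, (c j : ℂ) / (ζ - pole ε j) + ∑' j, (c j : ℂ) / pole ε j

/-- `γ₀`, the graph of `ω` over the unit circle. -/
def gamma0 (ε c : ℕ → ℝ) : Set (ℂ × ℂ) :=
  {q | ‖q.1‖ = 1 ∧ q.2 = omega ε c q.1}

/-- The graph of `ω` over `ℂ ∖ ({1} ∪ {a_j})`. -/
def graphOmega (ε c : ℕ → ℝ) : Set (ℂ × ℂ) :=
  {q | q.1 ≠ 1 ∧ (∀ j, q.1 ≠ pole ε j) ∧ q.2 = omega ε c q.1}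

/-- `W`, the closure in `P² ∖ L` of the graph of `ω`. -/
def W (ε c : ℕ → ℝ) : Set P2 := closure (affine '' graphOmega ε c) ∩ lineLᶜ

end ProjHull

/-!
The function `ω` is holomorphic off `1` and its simple poles `a_j`, which accumulate at `1`; it is
bounded outside the open unit disc, and `u ω(1/u)` is holomorphic at `u = 0`. Hence `W` is the graph
of `ω` together with the point `[0 : 1 : 0]` (`W_eq_completedGraph`): over the poles the graph only
accumulates at `ℓ ∈ L`. The Casorati–Weierstrass argument `exists_omega_near` shows that it
accumulates at every point of `L`, which gives the closure of the hull once the hull is known.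

*The hull contains `W` and `ℓ`.* For a homogeneous polynomial `P` and the product `B` of the first
`N` Blaschke factors with zeros `a_j`, the map `s ↦ (B, sB, Bω_N)` is holomorphic on the closed disc,
where `ω_N` is a partial sum of `ω`, and on the circle it runs in the cone over the graph of `ω_N`,
with a factor of modulus one. The maximum principle (`mem_projHull_of_discs`) bounds `P` on this
disc; as `∑ ε_j < ∞`, the products `B` stay away from zero at each point that is not a pole
(`exists_le_norm_prod_blaschke`), and `N → ∞` gives the points over the open unit disc. The
parameter `s = a_0` gives `ℓ`, and the discs `[u : 1 : u ω_N(1/u)]` give the points over the exterior.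

*The hull contains nothing else.* The homogenization of `∏_{j < N} (z - a_j) * (w - ω_N(z))` has
degree `N + 1` and is bounded on `γ₀` by `2 ^ N` times the tail `∑_{j ≥ N} c_j / ε_j`. The `c_j` are
taken so small that this tail is at most `∏_{j < N} ε_j / N!`. At any other point of `P²` except
`p = (1, ω(1))` the polynomial is at least of the order `r ^ N ∏_{j < N} ε_j`, so
`not_mem_projHull` applies (at the points `(1, w)` of `L` the
factors `1 - a_j` are the `ε_j`, which is why their product enters).

*Real analyticity.* An analytic parametrization of `γ₀` near `p` would, after complexification and
inversion of its first component, extend `ω` holomorphically from the circle to a neighbourhood of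
`1`. By the identity theorem on a half disc in the upper half plane the extension would agree with
`ω` there, but `ω` is unbounded near the poles on the boundary (`not_eventually_eq_omega`). The
first component has non-zero derivative because `∑ c_j / ε_j² < ∞` makes `ω` Lipschitz at `1`.

*Non-algebraicity.* In a polynomial equation between `ζ` and `ω(ζ)` the leading coefficient in `ω`
would vanish at the infinitely many poles (`eq_zero_of_evalEval_omega`).
-/

namespace ProjHull

/-! ### The function `ω` -/

/-- The sum `∑ c_j / (ζ - a_j)`, i.e. `ω` without its additive constant. Coefficients are allowed
to vanish, so that a polar part can be split off by updating `c`. -/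
noncomputable def cauchySum (ε c : ℕ → ℝ) (ζ : ℂ) : ℂ := ∑' j, (c j : ℂ) / (ζ - pole ε j)

/-- The additive constant `∑ c_j / a_j` of `ω`. -/
noncomputable def omegaConst (ε c : ℕ → ℝ) : ℂ := ∑' j, (c j : ℂ) / pole ε j

theorem omega_eq (ε c : ℕ → ℝ) (ζ : ℂ) : omega ε c ζ = cauchySum ε c ζ + omegaConst ε c := rfl

/-- The set `ℂ ∖ ({1} ∪ {a_j})` on which `ω` is holomorphic. -/
def dom (ε : ℕ → ℝ) : Set ℂ := {ζ | ζ ≠ 1 ∧ ∀ j, ζ ≠ pole ε j}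

theorem exists_pos_bound {f : ℕ → ℝ} {x : ℝ} (hf : Tendsto f atTop (𝓝 x)) :
    ∃ M, 0 < M ∧ ∀ n, f n ≤ M := by
  obtain ⟨M, hM⟩ := hf.bddAbove_range
  exact ⟨max M 1, by positivity, fun n => (hM ⟨n, rfl⟩).trans (le_max_left _ _)⟩

variable {ε c : ℕ → ℝ}

theorem tendsto_pole (hsum : Summable ε) : Tendsto (pole ε) atTop (𝓝 1) := by
  have h : Tendsto (fun j => ((1 - ε j : ℝ) : ℂ)) atTop (𝓝 ((1 - 0 : ℝ) : ℂ)) :=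
    (Complex.continuous_ofReal.tendsto _).comp (hsum.tendsto_atTop_zero.const_sub 1)
  rwa [sub_zero, Complex.ofReal_one] at h

theorem pole_injective (hinj : Function.Injective ε) : Function.Injective (pole ε) := by
  intro i j h
  simp only [pole, Complex.ofReal_inj] at h
  exact hinj (by linarith)

theorem norm_pole (hε : ∀ j, 0 < ε j ∧ ε j < 1) (j : ℕ) : ‖pole ε j‖ = 1 - ε j := by
  rw [pole, Complex.norm_real, Real.norm_eq_abs, abs_of_pos (by linarith [hε j])]

theorem pole_ne_one (hε : ∀ j, 0 < ε j ∧ ε j < 1) (j : ℕ) : pole ε j ≠ 1 := by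
  intro h
  have := norm_pole hε j
  rw [h, norm_one] at this
  linarith [hε j]

theorem le_norm_sub_pole (hε : ∀ j, 0 < ε j ∧ ε j < 1) {ζ : ℂ} (hζ : 1 ≤ ‖ζ‖) (j : ℕ) :
    ε j ≤ ‖ζ - pole ε j‖ := by
  have h := norm_sub_norm_le ζ (pole ε j)
  rw [norm_pole hε] at h
  linarith

theorem ne_pole_of_one_le (hε : ∀ j, 0 < ε j ∧ ε j < 1) {ζ : ℂ} (hζ : 1 ≤ ‖ζ‖) (j : ℕ) :
    ζ ≠ pole ε j := by
  intro h
  have := le_norm_sub_pole hε hζ j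
  rw [h, sub_self, norm_zero] at this
  linarith [hε j]

/-- Off the limit point `1`, the poles different from `ζ₀` stay away from `ζ₀`. The junk value
`0⁻¹ = 0` takes care of the pole at `ζ₀`, if there is one. -/
theorem exists_inv_norm_sub_pole_le (hsum : Summable ε) {ζ₀ : ℂ} (h1 : ζ₀ ≠ 1) :
    ∃ M, 0 < M ∧ ∀ j, ‖ζ₀ - pole ε j‖⁻¹ ≤ M :=
  exists_pos_bound (((tendsto_pole hsum).const_sub ζ₀).norm.inv₀
    (by simpa [sub_eq_zero] using h1))

theorem exists_ball_separated (hsum : Summable ε) {ζ₀ : ℂ} (h1 : ζ₀ ≠ 1) :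
    ∃ m, 0 < m ∧ ∀ ζ ∈ Metric.ball ζ₀ m, ∀ j, ζ₀ ≠ pole ε j → m ≤ ‖ζ - pole ε j‖ := by
  obtain ⟨M, hM, h⟩ := exists_inv_norm_sub_pole_le hsum h1
  refine ⟨M⁻¹ / 2, by positivity, fun ζ hζ j hj => ?_⟩
  have h2 : M⁻¹ ≤ ‖ζ₀ - pole ε j‖ := inv_le_of_inv_le₀ (by simpa [sub_eq_zero] using hj) (h j)
  have h3 := norm_sub_norm_le (ζ₀ - pole ε j) (ζ₀ - ζ)
  rw [Metric.mem_ball, dist_comm, dist_eq_norm] at hζ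
  rw [sub_sub_sub_cancel_left] at h3
  linarith

theorem isOpen_dom (hsum : Summable ε) : IsOpen (dom ε) := by
  rw [isOpen_iff_mem_nhds]
  rintro ζ₀ ⟨h1, h2⟩
  obtain ⟨m, hm, h⟩ := exists_ball_separated hsum h1
  filter_upwards [Metric.ball_mem_nhds ζ₀ hm, isOpen_ne.mem_nhds h1] with ζ hζ hζ1
  refine ⟨hζ1, fun j hj => ?_⟩
  have := h ζ hζ j (h2 j)
  rw [hj, sub_self, norm_zero] at this
  linarith

theorem eventually_cauchySum_differentiableAt (hsum : Summable ε) (hc : Summable c) {ζ₀ : ℂ}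
    (h1 : ζ₀ ≠ 1) (h2 : ∀ j, c j ≠ 0 → ζ₀ ≠ pole ε j) :
    ∀ᶠ ζ in 𝓝 ζ₀, DifferentiableAt ℂ (cauchySum ε c) ζ := by
  obtain ⟨m, hm, h⟩ := exists_ball_separated hsum h1
  have key : DifferentiableOn ℂ (cauchySum ε c) (Metric.ball ζ₀ m) := by
    refine Complex.differentiableOn_tsum_of_summable_norm (u := fun j => |c j| * m⁻¹)
      (hc.abs.mul_right _) (fun j => ?_) Metric.isOpen_ball fun j ζ hζ => ?_
    · by_cases hj : c j = 0
      · simp only [hj, Complex.ofReal_zero, zero_div]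
        exact differentiableOn_const _
      · refine (differentiableOn_const _).div (by fun_prop) fun ζ hζ h0 => ?_
        have := h ζ hζ j (h2 j hj)
        rw [h0, norm_zero] at this
        linarith
    · by_cases hj : c j = 0
      · simp [hj]
      · rw [norm_div, Complex.norm_real, Real.norm_eq_abs, div_eq_mul_inv]
        have := h ζ hζ j (h2 j hj)
        gcongr
  filter_upwards [Metric.ball_mem_nhds ζ₀ hm] with ζ hζ
  exact key.differentiableAt (Metric.isOpen_ball.mem_nhds hζ)

theorem omega_differentiableAt (hsum : Summable ε) (hc : Summable c) {ζ : ℂ} (hζ : ζ ∈ dom ε) :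
    DifferentiableAt ℂ (omega ε c) ζ :=
  (eventually_cauchySum_differentiableAt hsum hc hζ.1 fun j _ => hζ.2 j).self_of_nhds.add_const _

theorem omega_differentiableOn (hsum : Summable ε) (hc : Summable c) :
    DifferentiableOn ℂ (omega ε c) (dom ε) :=
  fun _ hζ => (omega_differentiableAt hsum hc hζ).differentiableWithinAt

theorem omega_analyticAt (hsum : Summable ε) (hc : Summable c) {ζ : ℂ} (hζ : ζ ∈ dom ε) :
    AnalyticAt ℂ (omega ε c) ζ :=
  (omega_differentiableOn hsum hc).analyticAt ((isOpen_dom hsum).mem_nhds hζ)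

theorem summable_cauchySum (hsum : Summable ε) (hc : Summable c) {ζ : ℂ} (h1 : ζ ≠ 1) :
    Summable fun j => (c j : ℂ) / (ζ - pole ε j) := by
  obtain ⟨M, hM, h⟩ := exists_inv_norm_sub_pole_le hsum h1
  refine Summable.of_norm_bounded (hc.abs.mul_right M) fun j => ?_
  rw [norm_div, Complex.norm_real, Real.norm_eq_abs, div_eq_mul_inv]
  gcongr
  exact h j

theorem cauchySum_update (hsum : Summable ε) (hc : Summable c) {ζ : ℂ} (h1 : ζ ≠ 1) (k : ℕ) :
    cauchySum ε c ζ = c k / (ζ - pole ε k) + cauchySum ε (Function.update c k 0) ζ := by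
  rw [cauchySum, (summable_cauchySum hsum hc h1).tsum_eq_add_tsum_ite k, cauchySum]
  congr 1
  refine tsum_congr fun j => ?_
  by_cases hj : j = k
  · simp [hj]
  · simp [hj]

theorem eventually_mem_dom_punctured (hε : ∀ j, 0 < ε j ∧ ε j < 1)
    (hinj : Function.Injective ε) (hsum : Summable ε) (k : ℕ) :
    ∀ᶠ ζ in 𝓝[≠] pole ε k, ζ ∈ dom ε := by
  obtain ⟨m, hm, h⟩ := exists_ball_separated hsum (pole_ne_one hε k)
  filter_upwards [mem_nhdsWithin_of_mem_nhds (Metric.ball_mem_nhds _ hm),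
    mem_nhdsWithin_of_mem_nhds (isOpen_ne.mem_nhds (pole_ne_one hε k)),
    self_mem_nhdsWithin] with ζ hζ h1 h2
  refine ⟨h1, fun j hj => ?_⟩
  by_cases hjk : j = k
  · exact h2 (hjk ▸ hj)
  · have := h ζ hζ j fun h => hjk (pole_injective hinj h).symm
    rw [hj, sub_self, norm_zero] at this
    linarith

theorem summable_update_zero (hc : Summable c) (k : ℕ) : Summable (Function.update c k 0) :=
  hc.update k 0

theorem tendsto_norm_omega_pole (hε : ∀ j, 0 < ε j ∧ ε j < 1) (hinj : Function.Injective ε)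
    (hsum : Summable ε) (hc : Summable c) {k : ℕ} (hck : c k ≠ 0) :
    Tendsto (fun ζ => ‖omega ε c ζ‖) (𝓝[≠] pole ε k) atTop := by
  have hcont : Tendsto (cauchySum ε (Function.update c k 0)) (𝓝[≠] pole ε k)
      (𝓝 (cauchySum ε (Function.update c k 0) (pole ε k))) := by
    refine Tendsto.mono_left (ContinuousAt.tendsto ?_) nhdsWithin_le_nhds
    refine (eventually_cauchySum_differentiableAt hsum (summable_update_zero hc k)
      (pole_ne_one hε k) fun j hj => ?_).self_of_nhds.continuousAt
    have hjk : j ≠ k := fun h => hj (by simp [h])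
    exact fun h => hjk (pole_injective hinj h).symm
  have hpole : Tendsto (fun ζ : ℂ => ‖(c k : ℂ) / (ζ - pole ε k)‖) (𝓝[≠] pole ε k) atTop := by
    have h0 : Tendsto (fun ζ : ℂ => ζ - pole ε k) (𝓝[≠] pole ε k) (𝓝[≠] 0) := by
      refine tendsto_nhdsWithin_iff.mpr ⟨?_, ?_⟩
      · refine Tendsto.mono_left ?_ nhdsWithin_le_nhds
        exact Continuous.tendsto' (by fun_prop) _ _ (sub_self _)
      · filter_upwards [self_mem_nhdsWithin] with ζ hζ
        exact sub_ne_zero.mpr hζ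
    have h1 := tendsto_norm_cobounded_atTop.comp (tendsto_inv₀_nhdsNE_zero.comp h0)
    simp only [div_eq_mul_inv, norm_mul]
    exact h1.const_mul_atTop (norm_pos_iff.mpr (Complex.ofReal_ne_zero.mpr hck))
  refine tendsto_atTop_mono' _ ?_
    (hpole.atTop_add (hcont.add_const (omegaConst ε c)).norm.neg)
  filter_upwards [eventually_mem_dom_punctured hε hinj hsum k] with ζ hζ
  rw [omega_eq, cauchySum_update hsum hc hζ.1 k, add_assoc]
  have := norm_sub_le_norm_add ((c k : ℂ) / (ζ - pole ε k))
    (cauchySum ε (Function.update c k 0) ζ + omegaConst ε c)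
  linarith

theorem mem_dom_of_one_le (hε : ∀ j, 0 < ε j ∧ ε j < 1) {ζ : ℂ} (hζ : 1 ≤ ‖ζ‖) (h1 : ζ ≠ 1) :
    ζ ∈ dom ε :=
  ⟨h1, ne_pole_of_one_le hε hζ⟩

theorem tendsto_pole_punctured (hε : ∀ j, 0 < ε j ∧ ε j < 1) (hsum : Summable ε) :
    Tendsto (pole ε) atTop (𝓝[≠] 1) :=
  tendsto_nhdsWithin_iff.mpr ⟨tendsto_pole hsum, .of_forall fun j => pole_ne_one hε j⟩

theorem frequently_mem_dom (hε : ∀ j, 0 < ε j ∧ ε j < 1) : ∃ᶠ ζ in 𝓝[≠] (1 : ℂ), ζ ∈ dom ε := by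
  have h : Tendsto (fun n : ℕ => (1 : ℂ) + 1 / ((n : ℂ) + 1)) atTop (𝓝[≠] 1) := by
    refine tendsto_nhdsWithin_iff.mpr ⟨?_, .of_forall fun n => ?_⟩
    · simpa using (tendsto_one_div_add_atTop_nhds_zero_nat (𝕜 := ℂ)).const_add 1
    · simpa using Nat.cast_add_one_ne_zero n
  refine h.frequently (Frequently.of_forall fun n => mem_dom_of_one_le hε ?_ ?_)
  · have h2 : (1 : ℂ) + 1 / ((n : ℂ) + 1) = ((1 + 1 / ((n : ℝ) + 1) : ℝ) : ℂ) := by push_cast; rfl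
    rw [h2, Complex.norm_real, Real.norm_eq_abs, abs_of_pos (by positivity)]
    have : (0 : ℝ) ≤ 1 / ((n : ℝ) + 1) := by positivity
    linarith
  · simpa using Nat.cast_add_one_ne_zero n

/-- A Casorati–Weierstrass theorem at the limit `1` of the poles: if `ω` stayed away from `w`
near `1`, then `1 / (ω - w)` would be holomorphic near `1`, with zeros accumulating there. -/
theorem exists_omega_near (hε : ∀ j, 0 < ε j ∧ ε j < 1) (hinj : Function.Injective ε)
    (hsum : Summable ε) (hc : Summable c) (hc0 : ∀ j, c j ≠ 0) (w : ℂ) {η : ℝ} (hη : 0 < η) :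
    ∃ ζ ∈ dom ε, ‖ζ - 1‖ < η ∧ ‖omega ε c ζ - w‖ < η := by
  classical
  by_contra! hcon
  set g : ℂ → ℂ := fun ζ => if ζ ∈ dom ε then (omega ε c ζ - w)⁻¹ else 0 with hg
  have hne : ∀ ζ ∈ dom ε, ‖ζ - 1‖ < η → omega ε c ζ - w ≠ 0 := fun ζ h1 h2 h3 => by
    have := hcon ζ h1 h2
    rw [h3, norm_zero] at this
    linarith
  have hdom : ∀ ζ ∈ dom ε, ‖ζ - 1‖ < η → DifferentiableAt ℂ g ζ := fun ζ h1 h2 => by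
    have h3 : (fun ζ => (omega ε c ζ - w)⁻¹) =ᶠ[𝓝 ζ] g := by
      filter_upwards [(isOpen_dom hsum).mem_nhds h1] with z hz
      simp [hg, hz]
    exact (((omega_differentiableAt hsum hc h1).sub_const w).inv (hne ζ h1 h2)).congr_of_eventuallyEq
      h3.symm
  have hpole0 : ∀ k, g (pole ε k) = 0 := fun k => by
    have : pole ε k ∉ dom ε := fun h => h.2 k rfl
    simp [hg, this]
  have hpole : ∀ k, ‖pole ε k - 1‖ < η → DifferentiableAt ℂ g (pole ε k) := fun k hk => by
    refine (Complex.analyticAt_of_differentiable_on_punctured_nhds_of_continuousAt ?_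
      ?_).differentiableAt
    · have h1 : ∀ᶠ ζ in 𝓝[≠] pole ε k, ‖ζ - 1‖ < η :=
        mem_nhdsWithin_of_mem_nhds ((isOpen_lt (by fun_prop) continuous_const).mem_nhds hk)
      filter_upwards [h1, eventually_mem_dom_punctured hε hinj hsum k] with ζ h1 h2
      exact hdom ζ h2 h1
    · rw [continuousAt_iff_punctured_nhds, hpole0]
      have h1 : Tendsto (fun ζ => ‖omega ε c ζ - w‖⁻¹) (𝓝[≠] pole ε k) (𝓝 0) := by
        refine tendsto_inv_atTop_zero.comp ?_
        refine tendsto_atTop_mono (fun ζ => norm_sub_norm_le _ _) ?_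
        exact tendsto_atTop_add_const_right _ (-‖w‖)
          (tendsto_norm_omega_pole hε hinj hsum hc (hc0 k))
      rw [tendsto_zero_iff_norm_tendsto_zero]
      refine h1.congr' ?_
      filter_upwards [eventually_mem_dom_punctured hε hinj hsum k] with ζ h2
      simp [hg, h2]
  have hdiff : DifferentiableOn ℂ g (Metric.ball 1 η \ {1}) := fun ζ hζ => by
    rw [Set.mem_sdiff, mem_ball_iff_norm, Set.mem_singleton_iff] at hζ
    refine DifferentiableAt.differentiableWithinAt ?_
    by_cases h : ∃ k, ζ = pole ε k
    · obtain ⟨k, rfl⟩ := h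
      exact hpole k hζ.1
    · exact hdom ζ ⟨hζ.2, fun k hk => h ⟨k, hk⟩⟩ hζ.1
  have hbdd : BddAbove (norm ∘ g '' (Metric.ball 1 η \ {1})) := by
    refine ⟨η⁻¹, ?_⟩
    rintro _ ⟨ζ, hζ, rfl⟩
    rw [Set.mem_sdiff, mem_ball_iff_norm] at hζ
    by_cases h : ζ ∈ dom ε
    · simp only [hg, Function.comp, h, if_true, norm_inv]
      exact inv_anti₀ hη (hcon ζ h hζ.1)
    · simp only [hg, Function.comp, h, if_false, norm_zero]
      positivity
  have hG := (Complex.differentiableOn_update_limUnder_of_bddAbove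
    (Metric.ball_mem_nhds 1 hη) hdiff hbdd).analyticAt (Metric.ball_mem_nhds 1 hη)
  rcases hG.eventually_eq_zero_or_eventually_ne_zero with h | h
  · have h1 : ∀ᶠ ζ : ℂ in 𝓝[≠] 1, ‖ζ - 1‖ < η :=
      mem_nhdsWithin_of_mem_nhds ((isOpen_lt (by fun_prop) continuous_const).mem_nhds
        (by simpa using hη))
    obtain ⟨ζ, h2, h3, h5⟩ := ((frequently_mem_dom hε).and_eventually
      ((h.filter_mono nhdsWithin_le_nhds).and h1)).exists
    rw [Function.update_of_ne h2.1] at h3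
    simp only [hg, h2, if_true, inv_eq_zero] at h3
    exact hne ζ h2 h5 h3
  · obtain ⟨k, hk⟩ := ((tendsto_pole_punctured hε hsum).eventually h).exists
    rw [Function.update_of_ne (pole_ne_one hε k)] at hk
    exact hk (hpole0 k)

/-! ### `ω` on and outside the unit circle -/

/-- The partial sums of `ω`, with the full additive constant. -/
noncomputable def omegaPartial (ε c : ℕ → ℝ) (N : ℕ) (ζ : ℂ) : ℂ :=
  ∑ j ∈ Finset.range N, (c j : ℂ) / (ζ - pole ε j) + omegaConst ε c

theorem tendsto_omegaPartial {ζ : ℂ} (h : Summable fun j => (c j : ℂ) / (ζ - pole ε j)) :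
    Tendsto (fun N => omegaPartial ε c N ζ) atTop (𝓝 (omega ε c ζ)) :=
  h.hasSum.tendsto_sum_nat.add_const _

theorem norm_term_le (hε : ∀ j, 0 < ε j ∧ ε j < 1) (hc : ∀ j, 0 < c j) {ζ : ℂ} (hζ : 1 ≤ ‖ζ‖)
    (j : ℕ) : ‖(c j : ℂ) / (ζ - pole ε j)‖ ≤ c j / ε j := by
  rw [norm_div, Complex.norm_real, Real.norm_eq_abs, abs_of_pos (hc j)]
  exact div_le_div_of_nonneg_left (hc j).le (hε j).1 (le_norm_sub_pole hε hζ j)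

theorem summable_of_one_le (hε : ∀ j, 0 < ε j ∧ ε j < 1) (hc : ∀ j, 0 < c j)
    (hcε : Summable fun j => c j / ε j) {ζ : ℂ} (hζ : 1 ≤ ‖ζ‖) :
    Summable fun j => (c j : ℂ) / (ζ - pole ε j) :=
  Summable.of_norm_bounded hcε fun j => norm_term_le hε hc hζ j

theorem norm_omega_sub_omegaPartial_le (hε : ∀ j, 0 < ε j ∧ ε j < 1) (hc : ∀ j, 0 < c j)
    (hcε : Summable fun j => c j / ε j) {ζ : ℂ} (hζ : 1 ≤ ‖ζ‖) (N : ℕ) :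
    ‖omega ε c ζ - omegaPartial ε c N ζ‖ ≤ ∑' j, c (j + N) / ε (j + N) := by
  have h := (summable_of_one_le hε hc hcε hζ).sum_add_tsum_nat_add N
  have h2 : omega ε c ζ - omegaPartial ε c N ζ
      = ∑' j, (c (j + N) : ℂ) / (ζ - pole ε (j + N)) := by
    rw [omega_eq, omegaPartial, cauchySum, ← h]
    ring
  rw [h2]
  exact tsum_of_norm_bounded ((summable_nat_add_iff N).mpr hcε).hasSum
    fun j => norm_term_le hε hc hζ (j + N)

theorem tendstoUniformlyOn_omegaPartial (hε : ∀ j, 0 < ε j ∧ ε j < 1) (hc : ∀ j, 0 < c j)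
    (hcε : Summable fun j => c j / ε j) :
    TendstoUniformlyOn (omegaPartial ε c) (omega ε c) atTop {ζ | 1 ≤ ‖ζ‖} := by
  rw [Metric.tendstoUniformlyOn_iff]
  intro η hη
  have h := tendsto_sum_nat_add fun j => c j / ε j
  filter_upwards [h.eventually (gt_mem_nhds hη)] with N hN ζ hζ
  rw [dist_eq_norm]
  exact (norm_omega_sub_omegaPartial_le hε hc hcε hζ N).trans_lt hN

theorem continuousOn_omegaPartial (hε : ∀ j, 0 < ε j ∧ ε j < 1) (N : ℕ) :
    ContinuousOn (omegaPartial ε c N) {ζ | 1 ≤ ‖ζ‖} := by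
  refine (continuousOn_finsetSum _ fun j _ => ?_).add continuousOn_const
  exact continuousOn_const.div (by fun_prop) fun ζ hζ =>
    sub_ne_zero.mpr (ne_pole_of_one_le hε hζ j)

theorem continuousOn_omega (hε : ∀ j, 0 < ε j ∧ ε j < 1) (hc : ∀ j, 0 < c j)
    (hcε : Summable fun j => c j / ε j) : ContinuousOn (omega ε c) {ζ | 1 ≤ ‖ζ‖} :=
  (tendstoUniformlyOn_omegaPartial hε hc hcε).continuousOn
    (Frequently.of_forall (continuousOn_omegaPartial hε))

theorem norm_omega_le (hε : ∀ j, 0 < ε j ∧ ε j < 1) (hc : ∀ j, 0 < c j)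
    (hcε : Summable fun j => c j / ε j) {ζ : ℂ} (hζ : 1 ≤ ‖ζ‖) :
    ‖omega ε c ζ‖ ≤ ∑' j, c j / ε j + ‖omegaConst ε c‖ :=
  (norm_add_le _ _).trans (add_le_add_left
    (tsum_of_norm_bounded hcε.hasSum fun j => norm_term_le hε hc hζ j) _)

theorem norm_omega_sub_omega_one_le (hε : ∀ j, 0 < ε j ∧ ε j < 1) (hc : ∀ j, 0 < c j)
    (hcε : Summable fun j => c j / ε j) (hcε2 : Summable fun j => c j / ε j ^ 2) {ζ : ℂ}
    (hζ : 1 ≤ ‖ζ‖) :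
    ‖omega ε c ζ - omega ε c 1‖ ≤ (∑' j, c j / ε j ^ 2) * ‖ζ - 1‖ := by
  have h1 : (1 : ℝ) ≤ ‖(1 : ℂ)‖ := by simp
  have h2 : omega ε c ζ - omega ε c 1
      = ∑' j, ((c j : ℂ) / (ζ - pole ε j) - (c j : ℂ) / (1 - pole ε j)) := by
    rw [(summable_of_one_le hε hc hcε hζ).tsum_sub (summable_of_one_le hε hc hcε h1), omega_eq,
      omega_eq, cauchySum, cauchySum]
    ring
  rw [h2]
  refine tsum_of_norm_bounded (hcε2.hasSum.mul_right _) fun j => ?_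
  have h3 := sub_ne_zero.mpr (ne_pole_of_one_le hε hζ j)
  have h4 := sub_ne_zero.mpr (ne_pole_of_one_le hε h1 j)
  have h5 : (c j : ℂ) / (ζ - pole ε j) - (c j : ℂ) / (1 - pole ε j)
      = -(c j : ℂ) * (ζ - 1) / ((ζ - pole ε j) * (1 - pole ε j)) := by
    field_simp
    ring
  rw [h5, norm_div, norm_mul, norm_mul, norm_neg, Complex.norm_real, Real.norm_eq_abs,
    abs_of_pos (hc j), div_mul_eq_mul_div, sq]
  have := le_norm_sub_pole hε hζ j
  have := le_norm_sub_pole hε h1 j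
  have := (hε j).1
  have := (hc j).le
  gcongr

/-- The function `u ↦ u ω(1/u)`, with value `0` at `0`, is holomorphic near `0`: it describes the
graph of `ω` near the point at infinity `[0 : 1 : 0]`. -/
theorem eventually_differentiableAt_omega_inv (hε : ∀ j, 0 < ε j ∧ ε j < 1) (hc : ∀ j, 0 < c j)
    (hsum : Summable ε) (hcs : Summable c) (hcε : Summable fun j => c j / ε j) :
    ∀ᶠ u : ℂ in 𝓝 0, DifferentiableAt ℂ (fun u => u * omega ε c u⁻¹) u := by
  have hlt : ∀ᶠ u : ℂ in 𝓝 0, ‖u‖ < 1 :=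
    (isOpen_lt continuous_norm continuous_const).mem_nhds (by simp)
  have hone : ∀ u : ℂ, u ≠ 0 → ‖u‖ < 1 → 1 < ‖u⁻¹‖ := fun u h0 h1 => by
    rw [norm_inv]
    exact (one_lt_inv₀ (norm_pos_iff.mpr h0)).mpr h1
  have hpunct : ∀ u : ℂ, u ≠ 0 → ‖u‖ < 1 →
      DifferentiableAt ℂ (fun u => u * omega ε c u⁻¹) u := fun u h0 h1 => by
    have h2 := hone u h0 h1
    have h3 : u⁻¹ ≠ 1 := fun h => by rw [h, norm_one] at h2; exact lt_irrefl _ h2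
    exact differentiableAt_id.mul ((omega_differentiableAt hsum hcs
      (mem_dom_of_one_le hε h2.le h3)).comp u (differentiableAt_inv h0))
  filter_upwards [hlt] with u hu
  by_cases h0 : u = 0
  · subst h0
    refine (Complex.analyticAt_of_differentiable_on_punctured_nhds_of_continuousAt ?_
      ?_).differentiableAt
    · filter_upwards [mem_nhdsWithin_of_mem_nhds hlt, self_mem_nhdsWithin] with u h1 h2
      exact hpunct u h2 h1
    · rw [continuousAt_iff_punctured_nhds, zero_mul]
      refine squeeze_zero_norm' (a := fun u => ‖u‖ * (∑' j, c j / ε j + ‖omegaConst ε c‖)) ?_ ?_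
      · filter_upwards [mem_nhdsWithin_of_mem_nhds hlt, self_mem_nhdsWithin] with u h1 h2
        rw [norm_mul]
        gcongr
        exact norm_omega_le hε hc hcε (hone u h2 h1).le
      · refine Tendsto.mono_left ?_ nhdsWithin_le_nhds
        exact Continuous.tendsto' (by fun_prop) _ _ (by simp)
  · exact hpunct u h0 hu

/-! ### Topology and coordinates of the projective plane -/

theorem isOpen_P2_iff {S : Set P2} : IsOpen S ↔ ∀ (v : C3) (hv : v ≠ 0),
    Projectivization.mk ℂ v hv ∈ S → ∀ᶠ v' in 𝓝 v, ∀ h : v' ≠ 0, Projectivization.mk ℂ v' h ∈ S := by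
  rw [isOpen_coinduced, isOpen_iff_eventually, Subtype.forall]
  refine forall₃_congr fun v hv hS => ?_
  rw [nhds_subtype_eq_comap, eventually_comap]
  constructor
  · intro h
    filter_upwards [h] with a ha hp using ha ⟨a, hp⟩ rfl
  · intro h
    filter_upwards [h] with a ha b hb
    subst hb
    exact ha b.2

theorem tendsto_mk {α : Type*} {l : Filter α} {f : α → C3} {g : α → P2} {v : C3} (hv : v ≠ 0)
    (hf : Tendsto f l (𝓝 v)) (hg : ∀ᶠ a in l, ∃ h, g a = Projectivization.mk ℂ (f a) h) :
    Tendsto g l (𝓝 (Projectivization.mk ℂ v hv)) := by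
  refine tendsto_nhds.mpr fun S hS hvS => ?_
  filter_upwards [hf.eventually (isOpen_P2_iff.mp hS v hv hvS), hg] with a h1 ⟨h2, h3⟩
  rw [Set.mem_preimage, h3]
  exact h1 h2

theorem tendsto_vec {α : Type*} {l : Filter α} {f g h : α → ℂ} {a b c : ℂ}
    (hf : Tendsto f l (𝓝 a)) (hg : Tendsto g l (𝓝 b)) (hh : Tendsto h l (𝓝 c)) :
    Tendsto (fun x => (!₂[f x, g x, h x] : C3)) l (𝓝 !₂[a, b, c]) := by
  refine ((PiLp.continuous_toLp 2 _).tendsto _).comp (tendsto_pi_nhds.mpr fun i => ?_)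
  fin_cases i <;> simpa

theorem continuous_affine : Continuous affine :=
  continuous_iff_continuousAt.mpr fun q => tendsto_mk (affine_ne_zero q.1 q.2)
    (tendsto_vec tendsto_const_nhds (continuous_fst.tendsto q) (continuous_snd.tendsto q))
    (.of_forall fun p => ⟨affine_ne_zero p.1 p.2, rfl⟩)

theorem eq_mk_of_smul_eq_rep {x : P2} {v : C3} (hv : v ≠ 0) (a : ℂ) (h : a • v = x.rep) :
    x = Projectivization.mk ℂ v hv := by
  rw [← x.mk_rep, Projectivization.mk_eq_mk_iff']
  exact ⟨a, h⟩

theorem exists_rep_mk (v : C3) (hv : v ≠ 0) :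
    ∃ a : ℂ, a ≠ 0 ∧ ∀ i, (Projectivization.mk ℂ v hv).rep i = a * v i := by
  obtain ⟨a, ha⟩ := Projectivization.exists_smul_eq_mk_rep ℂ v hv
  refine ⟨a, a.ne_zero, fun i => ?_⟩
  rw [← ha, Units.smul_def, PiLp.smul_apply, smul_eq_mul]

/-- The points of the projective plane whose `k`-th homogeneous coordinate does not vanish. -/
def chart (k : Fin 3) : Set P2 := {x | x.rep k ≠ 0}

/-- The quotient of the homogeneous coordinates `i` and `k`, an affine coordinate on `chart k`. -/
noncomputable def ratio (i k : Fin 3) (x : P2) : ℂ := x.rep i / x.rep k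

theorem mk_mem_chart {v : C3} (hv : v ≠ 0) {k : Fin 3} :
    Projectivization.mk ℂ v hv ∈ chart k ↔ v k ≠ 0 := by
  obtain ⟨a, ha, h⟩ := exists_rep_mk v hv
  simp [chart, h, ha]

theorem ratio_mk {v : C3} (hv : v ≠ 0) (i k : Fin 3) :
    ratio i k (Projectivization.mk ℂ v hv) = v i / v k := by
  obtain ⟨a, ha, h⟩ := exists_rep_mk v hv
  rw [ratio, h, h, mul_div_mul_left _ _ ha]

theorem isOpen_chart (k : Fin 3) : IsOpen (chart k) := by
  refine isOpen_P2_iff.mpr fun v hv h => ?_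
  rw [mk_mem_chart] at h
  filter_upwards [(isOpen_ne_fun (f := fun v : C3 => v k) (g := fun _ => 0) (by fun_prop)
    (by fun_prop)).mem_nhds h] with v' h1 h2
  exact (mk_mem_chart h2).mpr h1

theorem continuousAt_ratio (i : Fin 3) {k : Fin 3} {x : P2} (hx : x ∈ chart k) :
    ContinuousAt (ratio i k) x := by
  have key : ContinuousOn (ratio i k) (chart k) := by
    refine (continuousOn_open_iff (isOpen_chart k)).mpr fun S hS => isOpen_P2_iff.mpr
      fun v hv h => ?_
    rw [Set.mem_inter_iff, mk_mem_chart, Set.mem_preimage, ratio_mk] at h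
    have h1 : ContinuousAt (fun v : C3 => v i / v k) v :=
      ContinuousAt.div (by fun_prop) (by fun_prop) h.1
    filter_upwards [h1.preimage_mem_nhds (hS.mem_nhds h.2),
      (isOpen_ne_fun (f := fun v : C3 => v k) (g := fun _ => 0) (by fun_prop)
        (by fun_prop)).mem_nhds h.1] with v' h2 h3 h4
    rw [Set.mem_inter_iff, mk_mem_chart, Set.mem_preimage, ratio_mk]
    exact ⟨h3, h2⟩
  exact key.continuousAt ((isOpen_chart k).mem_nhds hx)

theorem affine_mem_chart (q : ℂ × ℂ) : affine q ∈ chart 0 :=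
  (mk_mem_chart _).mpr (by simp)

theorem ratio_one_affine (q : ℂ × ℂ) : ratio 1 0 (affine q) = q.1 := by
  rw [affine, ratio_mk]
  simp

theorem ratio_two_affine (q : ℂ × ℂ) : ratio 2 0 (affine q) = q.2 := by
  rw [affine, ratio_mk]
  simp

theorem affine_injective : Function.Injective affine := fun p q h =>
  Prod.ext (by rw [← ratio_one_affine, h, ratio_one_affine])
    (by rw [← ratio_two_affine, h, ratio_two_affine])

theorem eq_affine {x : P2} (hx : x ∈ chart 0) : x = affine (ratio 1 0 x, ratio 2 0 x) := by
  refine eq_mk_of_smul_eq_rep _ (x.rep 0) ?_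
  have hx : x.rep 0 ≠ 0 := hx
  ext i
  fin_cases i <;> simp [ratio, mul_div_cancel₀ _ hx]

theorem mem_lineL_iff {x : P2} (hx : x ∈ chart 0) : x ∈ lineL ↔ ratio 1 0 x = 1 :=
  (div_eq_one_iff_eq hx).symm

theorem affine_mem_lineL (q : ℂ × ℂ) : affine q ∈ lineL ↔ q.1 = 1 := by
  rw [mem_lineL_iff (affine_mem_chart q), ratio_one_affine]

theorem isOpen_compl_lineL : IsOpen lineLᶜ := by
  refine isOpen_P2_iff.mpr fun v hv h => ?_
  rw [Set.mem_compl_iff, mk_mem_lineL] at h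
  filter_upwards [(isOpen_ne_fun (f := fun v : C3 => v 1) (g := fun v => v 0) (by fun_prop)
    (by fun_prop)).mem_nhds h] with v' h1 h2
  rwa [Set.mem_compl_iff, mk_mem_lineL]

/-- Holomorphy may be checked on any function `F` of homogeneous coordinates that represents `f`. -/
theorem HolomorphicOn.of_cone {f : P2 → ℂ} {U : Set P2} (F : C3 → ℂ)
    (h : ∀ (v : C3) (hv : v ≠ 0), Projectivization.mk ℂ v hv ∈ U →
      f (Projectivization.mk ℂ v hv) = F v ∧ DifferentiableAt ℂ F v) : HolomorphicOn f U := by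
  classical
  have h1 : DifferentiableOn ℂ F {v | ∃ h : v ≠ 0, Projectivization.mk ℂ v h ∈ U} :=
    fun v ⟨hv, hU⟩ => (h v hv hU).2.differentiableWithinAt
  refine h1.congr fun v ⟨hv, hU⟩ => ?_
  rw [dif_pos hv, (h v hv hU).1]

theorem differentiableAt_div_coord (i k : Fin 3) {v : C3} (hv : v k ≠ 0) :
    DifferentiableAt ℂ (fun v : C3 => v i / v k) v := by
  have h (j : Fin 3) : DifferentiableAt ℂ (fun v : C3 => v j) v :=
    (EuclideanSpace.proj (𝕜 := ℂ) j).differentiableAt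
  simp only [div_eq_mul_inv]
  exact (h i).fun_mul ((differentiableAt_inv hv).fun_comp' v (h k))

/-! ### The closure of the graph of `ω` -/

/-- The point at infinity `[0 : 1 : 0]` of the horizontal lines. -/
noncomputable def pointInf : P2 :=
  Projectivization.mk ℂ !₂[0, 1, 0] fun h => by simpa using congrArg (fun v : C3 => v 1) h

theorem eq_pointInf {x : P2} (h0 : x.rep 0 = 0) (h2 : x.rep 2 = 0) : x = pointInf := by
  refine eq_mk_of_smul_eq_rep _ (x.rep 1) ?_
  ext i
  fin_cases i <;> simp [h0, h2]

theorem eq_ell {x : P2} (h0 : x.rep 0 = 0) (h1 : x.rep 1 = 0) : x = ell := by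
  refine eq_mk_of_smul_eq_rep _ (x.rep 2) ?_
  ext i
  fin_cases i <;> simp [h0, h1]

theorem ell_mem_lineL : ell ∈ lineL := by
  rw [ell, mk_mem_lineL]
  simp

theorem pointInf_not_mem_chart : pointInf ∉ chart 0 := by
  rw [pointInf, mk_mem_chart]
  simp

theorem pointInf_mem_chart : pointInf ∈ chart 1 := by
  rw [pointInf, mk_mem_chart]
  simp

theorem ratio_pointInf : ratio 0 1 pointInf = 0 := by
  rw [pointInf, ratio_mk]
  simp

theorem pointInf_not_mem_lineL : pointInf ∉ lineL := by
  rw [pointInf, mk_mem_lineL]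
  simp

theorem mem_graphOmega {q : ℂ × ℂ} : q ∈ graphOmega ε c ↔ q.1 ∈ dom ε ∧ q.2 = omega ε c q.1 :=
  and_assoc.symm

/-- The graph of `ω`, completed by the point at infinity. -/
def completedGraph (ε c : ℕ → ℝ) : Set P2 := affine '' graphOmega ε c ∪ {pointInf}

theorem affine_mem_completedGraph {q : ℂ × ℂ} :
    affine q ∈ completedGraph ε c ↔ q ∈ graphOmega ε c := by
  constructor
  · rintro (⟨p, hp, h⟩ | h)
    · exact affine_injective h ▸ hp
    · exact absurd (h ▸ affine_mem_chart q) pointInf_not_mem_chart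
  · exact fun h => Or.inl ⟨q, h, rfl⟩

theorem mem_completedGraph_chart_zero {x : P2} (hx : x ∈ chart 0) :
    x ∈ completedGraph ε c ↔ ratio 1 0 x ∈ dom ε ∧ ratio 2 0 x = omega ε c (ratio 1 0 x) := by
  conv_lhs => rw [eq_affine hx, affine_mem_completedGraph, mem_graphOmega]

/-- Near the point at infinity, the completed graph is the graph of `u ↦ u ω(1/u)`. -/
theorem mem_completedGraph_chart_one (hε : ∀ j, 0 < ε j ∧ ε j < 1) {x : P2} (hx : x ∈ chart 1)
    (hx' : ‖ratio 0 1 x‖ < 1) :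
    x ∈ completedGraph ε c ↔
      ratio 2 1 x = ratio 0 1 x * omega ε c (ratio 0 1 x)⁻¹ := by
  have h1 : x.rep 1 ≠ 0 := hx
  by_cases h0 : x.rep 0 = 0
  · have h2 : x ∈ completedGraph ε c ↔ x = pointInf := by
      refine ⟨?_, Or.inr⟩
      rintro (⟨q, -, rfl⟩ | h)
      · exact absurd h0 (affine_mem_chart q)
      · exact h
    rw [h2]
    constructor
    · rintro rfl
      rw [ratio_pointInf, zero_mul, pointInf, ratio_mk]
      simp
    · intro h
      rw [ratio, ratio, h0, zero_div, zero_mul, div_eq_zero_iff] at h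
      exact eq_pointInf h0 (h.resolve_right h1)
  · rw [mem_completedGraph_chart_zero h0]
    have hinv : (ratio 0 1 x)⁻¹ = ratio 1 0 x := inv_div _ _
    have hu : ratio 0 1 x ≠ 0 := div_ne_zero h0 h1
    have hone : 1 < ‖ratio 1 0 x‖ := by
      rw [← hinv, norm_inv]
      exact (one_lt_inv₀ (norm_pos_iff.mpr hu)).mpr hx'
    have hdom : ratio 1 0 x ∈ dom ε :=
      mem_dom_of_one_le hε hone.le fun h => by simp [h] at hone
    have h2 : ratio 2 1 x = ratio 0 1 x * ratio 2 0 x := by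
      simp only [ratio]
      field_simp
    rw [hinv, h2, and_iff_right hdom, mul_right_inj' hu]

theorem completedGraph_subset (ε c : ℕ → ℝ) : completedGraph ε c ⊆ lineLᶜ := by
  rintro x (⟨q, hq, rfl⟩ | rfl)
  · exact fun h => hq.1 ((affine_mem_lineL q).mp h)
  · exact pointInf_not_mem_lineL

/-- The completed graph is closed in the complement of `L`: it does not accumulate at the points
over the poles, as `ω` tends to infinity there. -/
theorem isClosed_completedGraph_union (hε : ∀ j, 0 < ε j ∧ ε j < 1)
    (hinj : Function.Injective ε) (hsum : Summable ε) (hc : ∀ j, 0 < c j) (hcs : Summable c)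
    (hcε : Summable fun j => c j / ε j) : IsClosed (completedGraph ε c ∪ lineL) := by
  rw [← isOpen_compl_iff, isOpen_iff_eventually]
  intro x hx
  rw [Set.mem_compl_iff, Set.mem_union, not_or] at hx
  obtain ⟨hxW, hxL⟩ := hx
  suffices h : ∀ᶠ y in 𝓝 x, y ∉ completedGraph ε c by
    filter_upwards [h, isOpen_compl_lineL.mem_nhds hxL] with y h1 h2 h3
    exact h3.elim h1 h2
  by_cases h0 : x ∈ chart 0
  · have hz := continuousAt_ratio 1 h0
    have hw := continuousAt_ratio 2 h0
    have hz1 : ratio 1 0 x ≠ 1 := fun h => hxL ((mem_lineL_iff h0).mpr h)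
    by_cases hdom : ratio 1 0 x ∈ dom ε
    · have h1 : ratio 2 0 x ≠ omega ε c (ratio 1 0 x) := fun h =>
        hxW ((mem_completedGraph_chart_zero h0).mpr ⟨hdom, h⟩)
      have h2 : ContinuousAt (fun y => omega ε c (ratio 1 0 y)) x :=
        ContinuousAt.comp (omega_differentiableAt hsum hcs hdom).continuousAt hz
      filter_upwards [(isOpen_chart 0).mem_nhds h0, (hw.ne_iff_eventually_ne h2).mp h1]
        with y h3 h4 h5
      exact h4 ((mem_completedGraph_chart_zero h3).mp h5).2
    · obtain ⟨k, hk⟩ : ∃ k, ratio 1 0 x = pole ε k := by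
        by_contra! h
        exact hdom ⟨hz1, h⟩
      have h1 := (tendsto_norm_omega_pole hε hinj hsum hcs (hc k).ne').eventually_gt_atTop
        (‖ratio 2 0 x‖ + 1)
      rw [eventually_nhdsWithin_iff, ← hk] at h1
      have h2 : ∀ᶠ y in 𝓝 x, ‖ratio 2 0 y‖ < ‖ratio 2 0 x‖ + 1 :=
        hw.norm.eventually (gt_mem_nhds (lt_add_one _))
      filter_upwards [(isOpen_chart 0).mem_nhds h0, hz.eventually h1, h2] with y h3 h4 h5 h6
      obtain ⟨h7, h8⟩ := (mem_completedGraph_chart_zero h3).mp h6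
      rw [h8] at h5
      exact lt_asymm h5 (h4 fun h => h7.2 k (h.trans hk))
  · have h0 : x.rep 0 = 0 := not_not.mp h0
    have h1 : x ∈ chart 1 := fun h1 => hxL (h1.trans h0.symm)
    have hu : ratio 0 1 x = 0 := by rw [ratio, h0, zero_div]
    have hw : ratio 2 1 x ≠ ratio 0 1 x * omega ε c (ratio 0 1 x)⁻¹ := fun h =>
      hxW ((mem_completedGraph_chart_one hε h1 (by simp [hu])).mpr h)
    have h2 : ContinuousAt (fun y => ratio 0 1 y * omega ε c (ratio 0 1 y)⁻¹) x :=
      ContinuousAt.comp (g := fun u => u * omega ε c u⁻¹) (by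
        rw [hu]
        exact (eventually_differentiableAt_omega_inv hε hc hsum hcs
          hcε).self_of_nhds.continuousAt) (continuousAt_ratio 0 h1)
    have h3 : ∀ᶠ y in 𝓝 x, ‖ratio 0 1 y‖ < 1 :=
      (continuousAt_ratio 0 h1).norm.eventually (gt_mem_nhds (by simp [hu]))
    filter_upwards [(isOpen_chart 1).mem_nhds h1, h3,
      ((continuousAt_ratio 2 h1).ne_iff_eventually_ne h2).mp hw] with y h4 h5 h6 h7
    exact h6 ((mem_completedGraph_chart_one hε h4 h5).mp h7)

theorem pointInf_mem_closure (hε : ∀ j, 0 < ε j ∧ ε j < 1) (hc : ∀ j, 0 < c j)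
    (hsum : Summable ε) (hcs : Summable c) (hcε : Summable fun j => c j / ε j) :
    pointInf ∈ closure (affine '' graphOmega ε c) := by
  have h1 : Tendsto (fun u : ℂ => affine (u⁻¹, omega ε c u⁻¹)) (𝓝[≠] 0) (𝓝 pointInf) := by
    refine tendsto_mk (f := fun u => !₂[u, 1, u * omega ε c u⁻¹]) _ (tendsto_vec
      (tendsto_id.mono_left nhdsWithin_le_nhds) tendsto_const_nhds ?_) ?_
    · have := (eventually_differentiableAt_omega_inv hε hc hsum hcs
        hcε).self_of_nhds.continuousAt.tendsto
      rw [zero_mul] at this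
      exact this.mono_left nhdsWithin_le_nhds
    · filter_upwards [self_mem_nhdsWithin] with u hu
      have hu : u ≠ 0 := hu
      refine ⟨fun h => by simpa using congrArg (fun v : C3 => v 1) h, ?_⟩
      rw [affine, Projectivization.mk_eq_mk_iff']
      refine ⟨u⁻¹, ?_⟩
      ext i
      fin_cases i <;> simp [hu]
  refine mem_closure_of_tendsto h1 ?_
  have h2 : ∀ᶠ u : ℂ in 𝓝[≠] 0, ‖u‖ < 1 :=
    mem_nhdsWithin_of_mem_nhds ((isOpen_lt continuous_norm continuous_const).mem_nhds (by simp))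
  filter_upwards [h2, self_mem_nhdsWithin] with u h3 h4
  have h5 : 1 < ‖u⁻¹‖ := by
    rw [norm_inv]
    exact (one_lt_inv₀ (norm_pos_iff.mpr h4)).mpr h3
  exact ⟨_, mem_graphOmega.mpr ⟨mem_dom_of_one_le hε h5.le fun h => by
    rw [show u⁻¹ = 1 from h, norm_one] at h5
    exact lt_irrefl _ h5, rfl⟩, rfl⟩

theorem W_eq_completedGraph (hε : ∀ j, 0 < ε j ∧ ε j < 1)
    (hinj : Function.Injective ε) (hsum : Summable ε) (hc : ∀ j, 0 < c j) (hcs : Summable c)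
    (hcε : Summable fun j => c j / ε j) : W ε c = completedGraph ε c := by
  apply Set.Subset.antisymm
  · rintro x ⟨h1, h2⟩
    have h3 := closure_minimal (Set.subset_union_left.trans Set.subset_union_left)
      (isClosed_completedGraph_union hε hinj hsum hc hcs hcε) h1
    exact h3.resolve_right h2
  · refine fun x hx => ⟨?_, completedGraph_subset ε c hx⟩
    rcases hx with hx | rfl
    · exact subset_closure hx
    · exact pointInf_mem_closure hε hc hsum hcs hcε

/-- Every point of `L` is a limit of points of the graph, by the Casorati–Weierstrass theorem
for `ω` at `1`. -/
theorem lineL_subset_closure (hε : ∀ j, 0 < ε j ∧ ε j < 1) (hinj : Function.Injective ε)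
    (hsum : Summable ε) (hc : ∀ j, 0 < c j) (hcs : Summable c) :
    lineL ⊆ closure (affine '' graphOmega ε c) := by
  have h1 (w : ℂ) : affine (1, w) ∈ closure (affine '' graphOmega ε c) := by
    refine image_closure_subset_closure_image continuous_affine ⟨(1, w), ?_, rfl⟩
    refine Metric.mem_closure_iff.mpr fun η hη => ?_
    obtain ⟨ζ, h1, h2, h3⟩ := exists_omega_near hε hinj hsum hcs (fun j => (hc j).ne') w hη
    refine ⟨(ζ, omega ε c ζ), mem_graphOmega.mpr ⟨h1, rfl⟩, ?_⟩
    rw [dist_comm, Prod.dist_eq, dist_eq_norm, dist_eq_norm]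
    exact max_lt h2 h3
  intro x hx
  by_cases h0 : x ∈ chart 0
  · rw [eq_affine h0, (mem_lineL_iff h0).mp hx]
    exact h1 _
  · have h0 : x.rep 0 = 0 := not_not.mp h0
    have hx : x.rep 1 = x.rep 0 := hx
    rw [eq_ell h0 (hx.trans h0)]
    have h2 : Tendsto (fun s : ℂ => affine (1, s⁻¹)) (𝓝[≠] 0) (𝓝 ell) := by
      refine tendsto_mk (f := fun s => !₂[s, s, 1]) _ (tendsto_vec
        (tendsto_id.mono_left nhdsWithin_le_nhds) (tendsto_id.mono_left nhdsWithin_le_nhds)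
        tendsto_const_nhds) ?_
      filter_upwards [self_mem_nhdsWithin] with s hs
      have hs : s ≠ 0 := hs
      refine ⟨fun h => by simpa using congrArg (fun v : C3 => v 2) h, ?_⟩
      rw [affine, Projectivization.mk_eq_mk_iff']
      refine ⟨s⁻¹, ?_⟩
      ext i
      fin_cases i <;> simp [hs]
    exact isClosed_closure.mem_of_tendsto h2 (.of_forall fun s => h1 _)

/-! ### Analyticity of `W` -/

theorem isAnalyticSubvariety_completedGraph (hε : ∀ j, 0 < ε j ∧ ε j < 1)
    (hinj : Function.Injective ε) (hsum : Summable ε) (hc : ∀ j, 0 < c j) (hcs : Summable c)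
    (hcε : Summable fun j => c j / ε j) : IsAnalyticSubvariety (completedGraph ε c) lineLᶜ := by
  refine ⟨completedGraph_subset ε c, fun x hxL => ?_⟩
  by_cases hx : x ∈ completedGraph ε c
  swap
  · refine ⟨(completedGraph ε c ∪ lineL)ᶜ,
      (isClosed_completedGraph_union hε hinj hsum hc hcs hcε).isOpen_compl,
      fun h => h.elim hx hxL, Set.compl_subset_compl.mpr Set.subset_union_right,
      1, fun _ _ => 1, fun _ => .of_cone (fun _ => 1) fun v hv _ => ⟨rfl, by fun_prop⟩, ?_⟩
    ext y
    simp only [Set.mem_inter_iff, Set.mem_compl_iff, Set.mem_union, Set.mem_ofPred_eq, one_ne_zero]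
    tauto
  rcases hx with ⟨q, hq, rfl⟩ | rfl
  · have hq := mem_graphOmega.mp hq
    have hcont : ContinuousOn (ratio 1 0) (chart 0) := fun y hy =>
      (continuousAt_ratio 1 hy).continuousWithinAt
    refine ⟨chart 0 ∩ ratio 1 0 ⁻¹' dom ε,
      hcont.isOpen_inter_preimage (isOpen_chart 0) (isOpen_dom hsum),
      ⟨affine_mem_chart q, by rw [Set.mem_preimage, ratio_one_affine]; exact hq.1⟩,
      fun y hy hyL => hy.2.1 ((mem_lineL_iff hy.1).mp hyL),
      1, fun _ y => ratio 2 0 y - omega ε c (ratio 1 0 y), fun _ => .of_cone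
        (fun v => v 2 / v 0 - omega ε c (v 1 / v 0)) fun v hv hU => ⟨by simp only [ratio_mk], ?_⟩, ?_⟩
    · rw [Set.mem_inter_iff, mk_mem_chart, Set.mem_preimage, ratio_mk] at hU
      exact (differentiableAt_div_coord 2 0 hU.1).sub
        (DifferentiableAt.comp v (omega_differentiableAt hsum hcs hU.2)
          (differentiableAt_div_coord 1 0 hU.1))
    · ext y
      constructor
      · exact fun ⟨h1, h2⟩ => ⟨h2, fun _ =>
          sub_eq_zero.mpr ((mem_completedGraph_chart_zero h2.1).mp h1).2⟩
      · exact fun ⟨h1, h2⟩ => ⟨(mem_completedGraph_chart_zero h1.1).mpr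
          ⟨h1.2, sub_eq_zero.mp (h2 0)⟩, h1⟩
  · have h := (eventually_differentiableAt_omega_inv hε hc hsum hcs hcε).and
      ((isOpen_lt continuous_norm (continuous_const (y := (1 : ℝ)))).mem_nhds
        (show (0 : ℂ) ∈ {u : ℂ | ‖u‖ < 1} by simp))
    obtain ⟨r, hr, h⟩ := Metric.eventually_nhds_iff_ball.mp h
    have hcont : ContinuousOn (ratio 0 1) (chart 1) := fun y hy =>
      (continuousAt_ratio 0 hy).continuousWithinAt
    refine ⟨chart 1 ∩ ratio 0 1 ⁻¹' Metric.ball 0 r,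
      hcont.isOpen_inter_preimage (isOpen_chart 1) Metric.isOpen_ball,
      ⟨pointInf_mem_chart, by rw [Set.mem_preimage, ratio_pointInf]; exact Metric.mem_ball_self hr⟩,
      fun y hy hyL => ?_,
      1, fun _ y => ratio 2 1 y - ratio 0 1 y * omega ε c (ratio 0 1 y)⁻¹, fun _ => .of_cone
        (fun v => v 2 / v 1 - (fun u => u * omega ε c u⁻¹) (v 0 / v 1))
        fun v hv hU => ⟨by simp only [ratio_mk], ?_⟩, ?_⟩
    · have h1 : ‖ratio 0 1 y‖ < 1 := (h _ hy.2).2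
      have h2 : y.rep 1 = y.rep 0 := hyL
      rw [ratio, ← h2, div_self hy.1, norm_one] at h1
      exact lt_irrefl _ h1
    · rw [Set.mem_inter_iff, mk_mem_chart, Set.mem_preimage, ratio_mk] at hU
      exact (differentiableAt_div_coord 2 1 hU.1).sub
        (DifferentiableAt.fun_comp' v (h _ hU.2).1 (differentiableAt_div_coord 0 1 hU.1))
    · ext y
      constructor
      · exact fun ⟨h1, h2⟩ => ⟨h2, fun _ =>
          sub_eq_zero.mpr ((mem_completedGraph_chart_one hε h2.1 (h _ h2.2).2).mp h1)⟩
      · exact fun ⟨h1, h2⟩ => ⟨(mem_completedGraph_chart_one hε h1.1 (h _ h1.2).2).mpr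
          (sub_eq_zero.mp (h2 0)), h1⟩

/-- A parametrization with a continuous left inverse maps the neighbourhoods of the parameter onto
the neighbourhoods of the point. -/
theorem map_nhds_eq_nhdsWithin {X Y : Type*} [TopologicalSpace X] [TopologicalSpace Y] {A : Set Y}
    {φ : X → Y} {ρ : Y → X} {s : X} (hφ : ContinuousAt φ s) (hA : ∀ᶠ t in 𝓝 s, φ t ∈ A)
    (hρ : ContinuousWithinAt ρ A (φ s)) (hρs : ρ (φ s) = s)
    (hinv : ∀ᶠ y in 𝓝[A] (φ s), φ (ρ y) = y) : map φ (𝓝 s) = 𝓝[A] (φ s) := by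
  apply le_antisymm
  · exact tendsto_nhdsWithin_iff.mpr ⟨hφ, hA⟩
  · have h1 : map (φ ∘ ρ) (𝓝[A] (φ s)) = 𝓝[A] (φ s) := by
      rw [Filter.map_congr (show φ ∘ ρ =ᶠ[_] id from hinv), map_id]
    have h2 : map ρ (𝓝[A] (φ s)) ≤ 𝓝 s := by
      have := hρ.tendsto
      rwa [hρs] at this
    calc 𝓝[A] (φ s) = map φ (map ρ (𝓝[A] (φ s))) := by rw [map_map, h1]
      _ ≤ map φ (𝓝 s) := map_mono h2

theorem isComplexCurveAt_affine (hsum : Summable ε) (hcs : Summable c) {q : ℂ × ℂ}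
    (hq : q ∈ graphOmega ε c) : IsComplexCurveAt (completedGraph ε c) (affine q) := by
  obtain ⟨z, w⟩ := q
  obtain ⟨hz, hw⟩ : z ∈ dom ε ∧ w = omega ε c z := mem_graphOmega.mp hq
  subst hw
  have hdiff : AnalyticAt ℂ (fun s => omega ε c (z + s)) 0 :=
    AnalyticAt.fun_comp (by simpa using omega_analyticAt hsum hcs hz) (by fun_prop)
  have hφ0 : affine (z + 0, omega ε c (z + 0)) = affine (z, omega ε c z) := by rw [add_zero]
  have hdom : ∀ᶠ s in 𝓝 (0 : ℂ), z + s ∈ dom ε := by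
    have : Tendsto (fun s : ℂ => z + s) (𝓝 0) (𝓝 z) :=
      Continuous.tendsto' (by fun_prop) _ _ (add_zero z)
    exact this.eventually ((isOpen_dom hsum).mem_nhds hz)
  have hψ' : HasDerivAt (fun s => ![1, z + s, omega ε c (z + s)])
      ![0, 1, deriv (fun s => omega ε c (z + s)) 0] 0 := by
    refine hasDerivAt_pi.mpr fun i => ?_
    fin_cases i
    · exact hasDerivAt_const _ _
    · exact (hasDerivAt_id _).const_add z
    · exact hdiff.differentiableAt.hasDerivAt
  have hψ : HasDerivAt (fun s => (!₂[1, z + s, omega ε c (z + s)] : C3))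
      !₂[0, 1, deriv (fun s => omega ε c (z + s)) 0] 0 :=
    (PiLp.continuousLinearEquiv 2 ℂ
      (fun _ : Fin 3 => ℂ)).symm.toContinuousLinearMap.hasFDerivAt.comp_hasDerivAt 0 hψ'
  refine ⟨fun s => affine (z + s, omega ε c (z + s)),
    fun s => !₂[1, z + s, omega ε c (z + s)], ?_, ?_, ?_, hφ0, ?_⟩
  · refine DifferentiableOn.analyticAt (s := {s | z + s ∈ dom ε})
      (differentiableOn_euclidean.mpr fun i => ?_) hdom
    fin_cases i
    · exact differentiableOn_const _
    · exact differentiableOn_id.const_add z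
    · exact fun s hs => ((omega_differentiableAt hsum hcs hs).fun_comp' s
        (differentiableAt_id.const_add z)).differentiableWithinAt
  · rw [hψ.deriv, LinearIndependent.pair_iff]
    intro a b hab
    have h0 := congrArg (fun v : C3 => v 0) hab
    have h1 := congrArg (fun v : C3 => v 1) hab
    simp at h0 h1
    subst h0
    simpa using h1
  · exact .of_forall fun s => ⟨affine_ne_zero _ _, rfl⟩
  · have h := map_nhds_eq_nhdsWithin (A := completedGraph ε c) (s := (0 : ℂ))
      (φ := fun s => affine (z + s, omega ε c (z + s))) (ρ := fun y => ratio 1 0 y - z)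
      (continuous_affine.continuousAt.comp (ContinuousAt.prodMk (by fun_prop) hdiff.continuousAt))
      (hdom.mono fun s hs => affine_mem_completedGraph.mpr (mem_graphOmega.mpr ⟨hs, rfl⟩))
      (((continuousAt_ratio 1 (affine_mem_chart _)).sub continuousAt_const).continuousWithinAt)
      (by simp [ratio_one_affine]) ?_
    · simpa only [hφ0] using! h
    · filter_upwards [mem_nhdsWithin_of_mem_nhds ((isOpen_chart 0).mem_nhds (affine_mem_chart _)),
        self_mem_nhdsWithin] with y h1 h2
      rw [add_sub_cancel, ← ((mem_completedGraph_chart_zero h1).mp h2).2, ← eq_affine h1]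

theorem hasPureDimensionOne_completedGraph (hε : ∀ j, 0 < ε j ∧ ε j < 1) (hc : ∀ j, 0 < c j)
    (hsum : Summable ε) (hcs : Summable c) (hcε : Summable fun j => c j / ε j) :
    HasPureDimensionOne (completedGraph ε c) := by
  refine ⟨⟨pointInf, Or.inr rfl⟩, ?_⟩
  have h1 : affine '' graphOmega ε c ⊆
      {x | x ∈ completedGraph ε c ∧ IsComplexCurveAt (completedGraph ε c) x} := by
    rintro _ ⟨q, hq, rfl⟩
    exact ⟨affine_mem_completedGraph.mpr hq, isComplexCurveAt_affine hsum hcs hq⟩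
  rintro x (hx | rfl)
  · exact subset_closure (h1 hx)
  · exact closure_mono h1 (pointInf_mem_closure hε hc hsum hcs hcε)

/-! ### The hull contains the completed graph -/

theorem eval_homogeneous {d : ℕ} {P : MvPolynomial (Fin 3) ℂ} (hP : P.IsHomogeneous d) (a : ℂ)
    (v : Fin 3 → ℂ) :
    MvPolynomial.eval (fun i => a * v i) P = a ^ d * MvPolynomial.eval v P := by
  rw [MvPolynomial.eval_eq', MvPolynomial.eval_eq', Finset.mul_sum]
  refine Finset.sum_congr rfl fun m hm => ?_
  have hd : ∑ i, m i = d := by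
    have := hP (MvPolynomial.mem_support_iff.mp hm)
    rw [← this, Finsupp.weight_apply, Finsupp.sum_fintype _ _ (by simp)]
    simp
  simp only [mul_pow, Finset.prod_mul_distrib, Finset.prod_pow_eq_pow_sum, hd]
  ring

theorem differentiableAt_eval (P : MvPolynomial (Fin 3) ℂ) {f : ℂ → Fin 3 → ℂ} {s : ℂ}
    (hf : ∀ i, DifferentiableAt ℂ (fun s => f s i) s) :
    DifferentiableAt ℂ (fun s => MvPolynomial.eval (f s) P) s := by
  induction P using MvPolynomial.induction_on with
  | C a => simp
  | add p q hp hq => simpa using! hp.add hq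
  | mul_X p i hp => simpa using! hp.mul (hf i)

theorem sectionNorm_nonneg (d : ℕ) (P : MvPolynomial (Fin 3) ℂ) (x : P2) :
    0 ≤ sectionNorm d P x := by
  unfold sectionNorm
  positivity

theorem subset_projHull (K : Set P2) : K ⊆ projHull K := fun x hx =>
  ⟨1, one_pos, fun d P _ M hM => by simpa using hM x hx⟩

theorem norm_le_of_bound_gamma0 {d : ℕ} {P : MvPolynomial (Fin 3) ℂ} (hP : P.IsHomogeneous d)
    {M R : ℝ} (hM : ∀ y ∈ affine '' gamma0 ε c, sectionNorm d P y ≤ M) {ζ : ℂ} (hζ : ‖ζ‖ = 1)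
    (hR : ‖(!₂[1, ζ, omega ε c ζ] : C3)‖ ≤ R) :
    ‖MvPolynomial.eval ![1, ζ, omega ε c ζ] P‖ ≤ R ^ d * M := by
  have h1 := hM _ ⟨(ζ, omega ε c ζ), ⟨hζ, rfl⟩, rfl⟩
  have h0 := (sectionNorm_nonneg d P _).trans h1
  rw [affine, sectionNorm_mk hP, div_le_iff₀ (pow_pos (norm_pos_iff.mpr (affine_ne_zero _ _)) d),
    mul_comm] at h1
  refine h1.trans ?_
  gcongr

theorem exists_norm_bound_gamma0 (hε : ∀ j, 0 < ε j ∧ ε j < 1) (hc : ∀ j, 0 < c j)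
    (hcε : Summable fun j => c j / ε j) :
    ∃ R, 0 < R ∧ ∀ ζ : ℂ, ‖ζ‖ = 1 → ‖(!₂[1, ζ, omega ε c ζ] : C3)‖ ≤ R := by
  have hcont : ContinuousOn (fun ζ => ‖(!₂[1, ζ, omega ε c ζ] : C3)‖) (Metric.sphere 0 1) := by
    refine ContinuousOn.norm fun ζ hζ => tendsto_vec tendsto_const_nhds
      (tendsto_id.mono_left nhdsWithin_le_nhds) ?_
    exact ((continuousOn_omega hε hc hcε).mono fun z hz => (mem_sphere_zero_iff_norm.mp hz).ge) ζ hζ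
  obtain ⟨R, hR⟩ := (isCompact_sphere (0 : ℂ) 1).bddAbove_image hcont
  refine ⟨max R 1, by positivity, fun ζ hζ => ?_⟩
  exact (hR ⟨ζ, by simpa using hζ, rfl⟩).trans (le_max_left _ _)

/-- A polynomial in `(ζ, ω_N(ζ))` converges uniformly on the circle. -/
theorem eventually_norm_eval_le (hε : ∀ j, 0 < ε j ∧ ε j < 1) (hc : ∀ j, 0 < c j)
    (hcε : Summable fun j => c j / ε j) (P : MvPolynomial (Fin 3) ℂ) {B η : ℝ} (hη : 0 < η)
    (hB : ∀ ζ : ℂ, ‖ζ‖ = 1 → ‖MvPolynomial.eval ![1, ζ, omega ε c ζ] P‖ ≤ B) :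
    ∀ᶠ N in atTop, ∀ ζ : ℂ, ‖ζ‖ = 1 →
      ‖MvPolynomial.eval ![1, ζ, omegaPartial ε c N ζ] P‖ ≤ B + η := by
  set A := ∑' j, c j / ε j + ‖omegaConst ε c‖ with hA
  set F : ℂ × ℂ → ℂ := fun q => MvPolynomial.eval ![1, q.1, q.2] P with hF
  have hFc : Continuous F := by
    refine (MvPolynomial.continuous_eval P).comp (continuous_pi fun i => ?_)
    fin_cases i
    · exact continuous_const
    · exact continuous_fst
    · exact continuous_snd
  have hcpt : IsCompact (Metric.closedBall (0 : ℂ) 1 ×ˢ Metric.closedBall (0 : ℂ) (A + 1)) :=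
    (isCompact_closedBall _ _).prod (isCompact_closedBall _ _)
  have huc := hcpt.uniformContinuousOn_of_continuous hFc.continuousOn
  obtain ⟨θ, hθ, hθF⟩ := Metric.uniformContinuousOn_iff.mp huc η hη
  have hunif := Metric.tendstoUniformlyOn_iff.mp (tendstoUniformlyOn_omegaPartial hε hc hcε)
    (min θ 1) (by positivity)
  filter_upwards [hunif] with N hN ζ hζ
  have h1 := hN ζ hζ.ge
  have h2 : ‖omega ε c ζ‖ ≤ A := norm_omega_le hε hc hcε hζ.ge
  have h3 : ‖omegaPartial ε c N ζ‖ ≤ A + 1 := by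
    rw [dist_comm, dist_eq_norm] at h1
    have := norm_le_norm_add_norm_sub' (omegaPartial ε c N ζ) (omega ε c ζ)
    linarith [min_le_right θ 1]
  have h4 := hθF (ζ, omega ε c ζ) ⟨by simp [hζ], by simp; linarith⟩ (ζ, omegaPartial ε c N ζ)
    ⟨by simp [hζ], by simpa using h3⟩ (by
      rw [Prod.dist_eq, dist_self]
      exact max_lt hθ (h1.trans_le (min_le_left _ _)))
  rw [dist_comm, dist_eq_norm] at h4
  have h5 := norm_le_norm_add_norm_sub' (F (ζ, omegaPartial ε c N ζ)) (F (ζ, omega ε c ζ))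
  have h6 := hB ζ hζ
  simp only [hF] at h4 h5
  linarith

/-- A point is in the hull if analytic discs `Φ N` with boundary on the cone over the graphs of the
partial sums of `ω` pass over points converging to it: the maximum principle applies to
`P ∘ Φ N`, and the factors `lam N` are controlled uniformly. -/
theorem mem_projHull_of_discs (hε : ∀ j, 0 < ε j ∧ ε j < 1) (hc : ∀ j, 0 < c j)
    (hcε : Summable fun j => c j / ε j) {Φ : ℕ → ℂ → Fin 3 → ℂ}
    (hΦ : ∀ N i s, ‖s‖ ≤ 1 → DifferentiableAt ℂ (fun s => Φ N s i) s)
    (hbd : ∀ N s, ‖s‖ = 1 → ∃ u ζ : ℂ, ‖u‖ = 1 ∧ ‖ζ‖ = 1 ∧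
      Φ N s = fun i => u * ![1, ζ, omegaPartial ε c N ζ] i)
    {s₀ : ℂ} (hs₀ : ‖s₀‖ ≤ 1) {v : C3} (hv : v ≠ 0) {b : ℝ} (hb : 0 < b) {lam : ℕ → ℂ}
    {vN : ℕ → Fin 3 → ℂ} (hlam : ∀ᶠ N in atTop, b ≤ ‖lam N‖)
    (hvN : Tendsto vN atTop (𝓝 fun i => v i))
    (hpt : ∀ᶠ N in atTop, Φ N s₀ = fun i => lam N * vN N i) :
    Projectivization.mk ℂ v hv ∈ projHull (affine '' gamma0 ε c) := by
  obtain ⟨R, hR, hRγ⟩ := exists_norm_bound_gamma0 hε hc hcε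
  have hvpos : 0 < ‖v‖ := norm_pos_iff.mpr hv
  refine ⟨R / (b * ‖v‖), by positivity, fun d P hP M hM => ?_⟩
  have hB : ∀ ζ : ℂ, ‖ζ‖ = 1 → ‖MvPolynomial.eval ![1, ζ, omega ε c ζ] P‖ ≤ R ^ d * M :=
    fun ζ hζ => norm_le_of_bound_gamma0 hP hM hζ (hRγ ζ hζ)
  have key : b ^ d * ‖MvPolynomial.eval (fun i => v i) P‖ ≤ R ^ d * M := by
    refine le_of_forall_pos_le_add fun η hη => ?_
    have hlim : Tendsto (fun N => b ^ d * ‖MvPolynomial.eval (vN N) P‖) atTop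
        (𝓝 (b ^ d * ‖MvPolynomial.eval (fun i => v i) P‖)) :=
      (((MvPolynomial.continuous_eval P).tendsto _).comp hvN).norm.const_mul _
    refine le_of_tendsto hlim ?_
    filter_upwards [hlam, hpt, eventually_norm_eval_le hε hc hcε P hη hB] with N h1 h2 h3
    have hmax : ‖MvPolynomial.eval (Φ N s₀) P‖ ≤ R ^ d * M + η := by
      refine Complex.norm_le_of_forall_mem_frontier_norm_le (U := Metric.ball (0 : ℂ) 1)
        (f := fun s => MvPolynomial.eval (Φ N s) P) Metric.isBounded_ball ?_ (fun s hs => ?_) ?_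
      · refine DifferentiableOn.diffContOnCl fun s hs => ?_
        rw [closure_ball _ one_ne_zero, mem_closedBall_zero_iff] at hs
        exact (differentiableAt_eval P fun i => hΦ N i s hs).differentiableWithinAt
      · rw [frontier_ball _ one_ne_zero, mem_sphere_zero_iff_norm] at hs
        obtain ⟨u, ζ, hu, hζ, h4⟩ := hbd N s hs
        rw [h4, eval_homogeneous hP, norm_mul, norm_pow, hu, one_pow, one_mul]
        exact h3 ζ hζ
      · rwa [closure_ball _ one_ne_zero, mem_closedBall_zero_iff]
    rw [h2, eval_homogeneous hP, norm_mul, norm_pow] at hmax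
    refine le_trans ?_ hmax
    gcongr
  rw [sectionNorm_mk hP, div_pow, mul_pow, div_le_iff₀ (by positivity)]
  calc ‖MvPolynomial.eval (fun i => v i) P‖
      = b ^ d * ‖MvPolynomial.eval (fun i => v i) P‖ / b ^ d := by field_simp
    _ ≤ R ^ d * M / b ^ d := by gcongr
    _ = R ^ d / (b ^ d * ‖v‖ ^ d) * M * ‖v‖ ^ d := by field_simp

theorem one_sub_pole_mul_ne_zero (hε : ∀ j, 0 < ε j ∧ ε j < 1) {s : ℂ} (hs : ‖s‖ ≤ 1) (k : ℕ) :
    1 - pole ε k * s ≠ 0 := by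
  intro h
  have h1 := congrArg norm (sub_eq_zero.mp h)
  rw [norm_one, norm_mul, norm_pole hε] at h1
  nlinarith [(hε k).1, (hε k).2, norm_nonneg s]

/-- The Blaschke factor of the unit disc with zero `a_k`. -/
noncomputable def blaschke (ε : ℕ → ℝ) (k : ℕ) (s : ℂ) : ℂ := (s - pole ε k) / (1 - pole ε k * s)

theorem blaschke_differentiableAt (hε : ∀ j, 0 < ε j ∧ ε j < 1) {s : ℂ} (hs : ‖s‖ ≤ 1) (k : ℕ) :
    DifferentiableAt ℂ (blaschke ε k) s :=
  DifferentiableAt.fun_div (by fun_prop) (by fun_prop) (one_sub_pole_mul_ne_zero hε hs k)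

theorem norm_blaschke (hε : ∀ j, 0 < ε j ∧ ε j < 1) {s : ℂ} (hs : ‖s‖ = 1) (k : ℕ) :
    ‖blaschke ε k s‖ = 1 := by
  have h0 := one_sub_pole_mul_ne_zero hε hs.le k
  have h1 : 1 - pole ε k * s = s * (starRingEnd ℂ) (s - pole ε k) := by
    rw [map_sub, pole, Complex.conj_ofReal, mul_sub, Complex.mul_conj, Complex.normSq_eq_norm_sq, hs]
    push_cast
    ring
  rw [blaschke, norm_div, div_eq_one_iff_eq (norm_ne_zero_iff.mpr h0), h1, norm_mul, hs, one_mul,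
    RCLike.norm_conj]

/-- A lower bound for the finite Blaschke products that do not vanish at `s`, uniform in the set of
factors. It relies on `∑ ε_j < ∞`. -/
theorem exists_le_norm_prod_blaschke (hε : ∀ j, 0 < ε j ∧ ε j < 1) (hsum : Summable ε) {s : ℂ}
    (hs : ‖s‖ ≤ 1) (h1 : s ≠ 1) :
    ∃ b, 0 < b ∧ ∀ F : Finset ℕ, (∀ k ∈ F, s ≠ pole ε k) → b ≤ ‖∏ k ∈ F, blaschke ε k s‖ := by
  obtain ⟨M, hM, hMs⟩ := exists_inv_norm_sub_pole_le hsum h1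
  refine ⟨Real.exp (-(2 * M * ∑' j, ε j)), Real.exp_pos _, fun F hF => ?_⟩
  calc Real.exp (-(2 * M * ∑' j, ε j)) ≤ Real.exp (∑ k ∈ F, -(2 * M * ε k)) := by
        rw [Finset.sum_neg_distrib, ← Finset.mul_sum]
        have := hsum.sum_le_tsum F fun j _ => (hε j).1.le
        gcongr
    _ = ∏ k ∈ F, Real.exp (-(2 * M * ε k)) := Real.exp_sum _ _
    _ ≤ ∏ k ∈ F, ‖blaschke ε k s‖ := by
        refine Finset.prod_le_prod (fun k _ => (Real.exp_pos _).le) fun k hk => ?_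
        have h0 : 0 < ‖s - pole ε k‖ := norm_pos_iff.mpr (sub_ne_zero.mpr (hF k hk))
        have h2 : 0 < ‖1 - pole ε k * s‖ := norm_pos_iff.mpr (one_sub_pole_mul_ne_zero hε hs k)
        have h3 : ‖1 - pole ε k * s‖ ≤ ‖s - pole ε k‖ * Real.exp (2 * M * ε k) := by
          have h4 : 1 - pole ε k * s = (ε k : ℂ) * (1 + s) - (s - pole ε k) := by
            rw [pole]
            push_cast
            ring
          have h5 : ‖1 + s‖ ≤ 2 := (norm_add_le _ _).trans (by rw [norm_one]; linarith)
          have h6 : 1 ≤ ‖s - pole ε k‖ * M := by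
            rw [← mul_inv_cancel₀ h0.ne']
            exact mul_le_mul_of_nonneg_left (hMs k) h0.le
          have h7 := Real.add_one_le_exp (2 * M * ε k)
          have h8 : ‖(ε k : ℂ) * (1 + s)‖ ≤ ε k * 2 := by
            rw [norm_mul, Complex.norm_real, Real.norm_eq_abs, abs_of_pos (hε k).1]
            exact mul_le_mul_of_nonneg_left h5 (hε k).1.le
          calc ‖1 - pole ε k * s‖ ≤ ‖(ε k : ℂ) * (1 + s)‖ + ‖s - pole ε k‖ := by
                rw [h4]
                exact norm_sub_le _ _
            _ ≤ ε k * 2 * (‖s - pole ε k‖ * M) + ‖s - pole ε k‖ :=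
                add_le_add_left (h8.trans (le_mul_of_one_le_right
                  (by linarith [(hε k).1]) h6)) _
            _ = ‖s - pole ε k‖ * (2 * M * ε k + 1) := by ring
            _ ≤ _ := mul_le_mul_of_nonneg_left h7 h0.le
        rw [blaschke, norm_div, le_div_iff₀ h2, Real.exp_neg, inv_mul_le_iff₀ (Real.exp_pos _),
          mul_comm (Real.exp _)]
        exact h3
    _ = ‖∏ k ∈ F, blaschke ε k s‖ := (norm_prod _ _).symm

/-- The function `B ω`, where `B` is the product of the first `N` Blaschke factors and `ω` is
replaced with its partial sum, in a form without poles. -/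
noncomputable def blaschkeOmega (ε c : ℕ → ℝ) (N : ℕ) (s : ℂ) : ℂ :=
  omegaConst ε c * ∏ k ∈ Finset.range N, blaschke ε k s +
    ∑ j ∈ Finset.range N,
      (c j : ℂ) / (1 - pole ε j * s) * ∏ k ∈ (Finset.range N).erase j, blaschke ε k s

theorem blaschkeOmega_eq (hε : ∀ j, 0 < ε j ∧ ε j < 1) {s : ℂ} (hs : ‖s‖ ≤ 1)
    (hpole : ∀ j, s ≠ pole ε j) (N : ℕ) :
    blaschkeOmega ε c N s = (∏ k ∈ Finset.range N, blaschke ε k s) * omegaPartial ε c N s := by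
  rw [blaschkeOmega, omegaPartial, mul_add, add_comm, mul_comm (omegaConst ε c), Finset.mul_sum]
  congr 1
  refine Finset.sum_congr rfl fun j hj => ?_
  rw [← Finset.mul_prod_erase _ _ hj, blaschke]
  have h1 := one_sub_pole_mul_ne_zero hε hs j
  have h2 := sub_ne_zero.mpr (hpole j)
  field_simp

/-- The analytic disc `[B : sB : Bω]`. -/
noncomputable def innerDisc (ε c : ℕ → ℝ) (N : ℕ) (s : ℂ) : Fin 3 → ℂ :=
  ![∏ k ∈ Finset.range N, blaschke ε k s, s * ∏ k ∈ Finset.range N, blaschke ε k s,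
    blaschkeOmega ε c N s]

theorem innerDisc_differentiableAt (hε : ∀ j, 0 < ε j ∧ ε j < 1) (N : ℕ) (i : Fin 3) {s : ℂ}
    (hs : ‖s‖ ≤ 1) : DifferentiableAt ℂ (fun s => innerDisc ε c N s i) s := by
  have h1 (F : Finset ℕ) : DifferentiableAt ℂ (fun s => ∏ k ∈ F, blaschke ε k s) s :=
    DifferentiableAt.fun_finsetProd fun k _ => blaschke_differentiableAt hε hs k
  fin_cases i
  · exact h1 (Finset.range N)
  · exact differentiableAt_id.fun_mul (h1 (Finset.range N))
  · refine ((h1 (Finset.range N)).const_mul _).fun_add (DifferentiableAt.fun_sum fun j _ => ?_)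
    refine DifferentiableAt.fun_mul ?_ (h1 _)
    exact (differentiableAt_const _).fun_div (by fun_prop) (one_sub_pole_mul_ne_zero hε hs j)

theorem innerDisc_eq (hε : ∀ j, 0 < ε j ∧ ε j < 1) {s : ℂ} (hs : ‖s‖ ≤ 1)
    (hpole : ∀ j, s ≠ pole ε j) (N : ℕ) :
    innerDisc ε c N s = fun i =>
      (∏ k ∈ Finset.range N, blaschke ε k s) * ![1, s, omegaPartial ε c N s] i := by
  funext i
  fin_cases i
  · simp [innerDisc]
  · simp [innerDisc, mul_comm]
  · simpa [innerDisc] using blaschkeOmega_eq hε hs hpole N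

theorem innerDisc_boundary (hε : ∀ j, 0 < ε j ∧ ε j < 1) (N : ℕ) (s : ℂ) (hs : ‖s‖ = 1) :
    ∃ u ζ : ℂ, ‖u‖ = 1 ∧ ‖ζ‖ = 1 ∧
      innerDisc ε c N s = fun i => u * ![1, ζ, omegaPartial ε c N ζ] i :=
  ⟨_, s, by simp [norm_prod, norm_blaschke hε hs], hs,
    innerDisc_eq hε hs.le (ne_pole_of_one_le hε hs.ge) N⟩

theorem tendsto_omegaPartial_vec {ζ : ℂ} (h : Summable fun j => (c j : ℂ) / (ζ - pole ε j)) :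
    Tendsto (fun N => ![1, ζ, omegaPartial ε c N ζ]) atTop
      (𝓝 fun i => (!₂[1, ζ, omega ε c ζ] : C3) i) := by
  refine tendsto_pi_nhds.mpr fun i => ?_
  fin_cases i
  · exact tendsto_const_nhds
  · exact tendsto_const_nhds
  · exact tendsto_omegaPartial h

theorem affine_mem_projHull_of_norm_lt (hε : ∀ j, 0 < ε j ∧ ε j < 1) (hsum : Summable ε)
    (hc : ∀ j, 0 < c j) (hcs : Summable c) (hcε : Summable fun j => c j / ε j) {ζ : ℂ}
    (hζ : ζ ∈ dom ε) (hlt : ‖ζ‖ < 1) :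
    affine (ζ, omega ε c ζ) ∈ projHull (affine '' gamma0 ε c) := by
  obtain ⟨b, hb, hbF⟩ := exists_le_norm_prod_blaschke hε hsum hlt.le hζ.1
  exact mem_projHull_of_discs hε hc hcε (fun N i s hs => innerDisc_differentiableAt hε N i hs)
    (innerDisc_boundary hε) hlt.le (affine_ne_zero _ _) hb
    (.of_forall fun N => hbF (Finset.range N) fun k _ => hζ.2 k)
    (tendsto_omegaPartial_vec (summable_cauchySum hsum hcs hζ.1))
    (.of_forall fun N => innerDisc_eq hε hlt.le hζ.2 N)

/-- The point `ℓ` lies on the discs `[B : sB : Bω]`, over the parameter `s = a_0`. -/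
theorem ell_mem_projHull (hε : ∀ j, 0 < ε j ∧ ε j < 1) (hinj : Function.Injective ε)
    (hsum : Summable ε) (hc : ∀ j, 0 < c j) (hcε : Summable fun j => c j / ε j) :
    ell ∈ projHull (affine '' gamma0 ε c) := by
  have hs : ‖pole ε 0‖ ≤ 1 := by
    rw [norm_pole hε]
    linarith [(hε 0).1]
  obtain ⟨b, hb, hbF⟩ := exists_le_norm_prod_blaschke hε hsum hs (pole_ne_one hε 0)
  have h0 : blaschke ε 0 (pole ε 0) = 0 := by rw [blaschke, sub_self, zero_div]
  have hprod (N : ℕ) (hN : 1 ≤ N) : ∏ k ∈ Finset.range N, blaschke ε k (pole ε 0) = 0 :=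
    Finset.prod_eq_zero (Finset.mem_range.mpr hN) h0
  have hG (N : ℕ) (hN : 1 ≤ N) : blaschkeOmega ε c N (pole ε 0)
      = (c 0 : ℂ) / (1 - pole ε 0 * pole ε 0) *
        ∏ k ∈ (Finset.range N).erase 0, blaschke ε k (pole ε 0) := by
    rw [blaschkeOmega, hprod N hN, mul_zero, zero_add]
    refine Finset.sum_eq_single_of_mem 0 (Finset.mem_range.mpr hN) fun j _ hj => ?_
    rw [Finset.prod_eq_zero (Finset.mem_erase.mpr ⟨hj.symm, Finset.mem_range.mpr hN⟩) h0, mul_zero]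
  have hne : (c 0 : ℂ) / (1 - pole ε 0 * pole ε 0) ≠ 0 :=
    div_ne_zero (Complex.ofReal_ne_zero.mpr (hc 0).ne') (one_sub_pole_mul_ne_zero hε hs 0)
  refine mem_projHull_of_discs hε hc hcε (fun N i s hs => innerDisc_differentiableAt hε N i hs)
    (innerDisc_boundary hε) hs vertical_ne_zero (mul_pos (norm_pos_iff.mpr hne) hb)
    (lam := fun N => blaschkeOmega ε c N (pole ε 0)) (vN := fun _ => ![0, 0, 1]) ?_
    tendsto_const_nhds ?_
  · filter_upwards [eventually_ge_atTop 1] with N hN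
    rw [hG N hN, norm_mul]
    refine mul_le_mul_of_nonneg_left (hbF _ fun k hk h => ?_) (norm_nonneg _)
    exact (Finset.ne_of_mem_erase hk) (pole_injective hinj h).symm
  · filter_upwards [eventually_ge_atTop 1] with N hN
    funext i
    fin_cases i <;> simp [innerDisc, hprod N hN]

/-- The analytic disc `[u : 1 : u ω(1/u)]`, with `ω` replaced with its partial sum. -/
noncomputable def outerDisc (ε c : ℕ → ℝ) (N : ℕ) (u : ℂ) : Fin 3 → ℂ :=
  ![u, 1, ∑ j ∈ Finset.range N, (c j : ℂ) * u ^ 2 / (1 - pole ε j * u) + omegaConst ε c * u]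

theorem outerDisc_differentiableAt (hε : ∀ j, 0 < ε j ∧ ε j < 1) (N : ℕ) (i : Fin 3) {u : ℂ}
    (hu : ‖u‖ ≤ 1) : DifferentiableAt ℂ (fun u => outerDisc ε c N u i) u := by
  fin_cases i
  · exact differentiableAt_id
  · exact differentiableAt_const _
  · refine DifferentiableAt.fun_add (DifferentiableAt.fun_sum fun j _ => ?_)
      (differentiableAt_id.const_mul _)
    exact DifferentiableAt.fun_div (by fun_prop) (by fun_prop) (one_sub_pole_mul_ne_zero hε hu j)

theorem outerDisc_eq (hε : ∀ j, 0 < ε j ∧ ε j < 1) {u : ℂ} (hu : ‖u‖ ≤ 1) (h0 : u ≠ 0) (N : ℕ) :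
    outerDisc ε c N u = fun i => u * ![1, u⁻¹, omegaPartial ε c N u⁻¹] i := by
  funext i
  fin_cases i
  · simp [outerDisc]
  · simp [outerDisc, h0]
  · simp only [outerDisc, omegaPartial, Fin.reduceFinMk, Matrix.cons_val, mul_add, Finset.mul_sum]
    congr 1
    · refine Finset.sum_congr rfl fun j _ => ?_
      have h1 := one_sub_pole_mul_ne_zero hε hu j
      have h2 : u⁻¹ - pole ε j = (1 - pole ε j * u) / u := by field_simp
      rw [h2]
      field_simp
    · ring

theorem outerDisc_boundary (hε : ∀ j, 0 < ε j ∧ ε j < 1) (N : ℕ) (s : ℂ) (hs : ‖s‖ = 1) :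
    ∃ u ζ : ℂ, ‖u‖ = 1 ∧ ‖ζ‖ = 1 ∧
      outerDisc ε c N s = fun i => u * ![1, ζ, omegaPartial ε c N ζ] i :=
  ⟨s, s⁻¹, hs, by rw [norm_inv, hs, inv_one],
    outerDisc_eq hε hs.le (norm_ne_zero_iff.mp (by rw [hs]; exact one_ne_zero)) N⟩

theorem affine_mem_projHull_of_one_lt_norm (hε : ∀ j, 0 < ε j ∧ ε j < 1)
    (hc : ∀ j, 0 < c j) (hcε : Summable fun j => c j / ε j) {ζ : ℂ} (hlt : 1 < ‖ζ‖) :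
    affine (ζ, omega ε c ζ) ∈ projHull (affine '' gamma0 ε c) := by
  have h0 : ζ ≠ 0 := norm_pos_iff.mp (one_pos.trans hlt)
  have hinv : ‖ζ⁻¹‖ ≤ 1 := by
    rw [norm_inv]
    exact inv_le_one_of_one_le₀ hlt.le
  refine mem_projHull_of_discs hε hc hcε (fun N i s hs => outerDisc_differentiableAt hε N i hs)
    (outerDisc_boundary hε) hinv (affine_ne_zero _ _) (norm_pos_iff.mpr (inv_ne_zero h0))
    (lam := fun _ => ζ⁻¹) (.of_forall fun N => le_rfl)
    (tendsto_omegaPartial_vec (summable_of_one_le hε hc hcε hlt.le)) (.of_forall fun N => ?_)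
  simpa only [inv_inv] using outerDisc_eq hε hinv (inv_ne_zero h0) N

theorem pointInf_mem_projHull (hε : ∀ j, 0 < ε j ∧ ε j < 1)
    (hc : ∀ j, 0 < c j) (hcε : Summable fun j => c j / ε j) :
    pointInf ∈ projHull (affine '' gamma0 ε c) := by
  refine mem_projHull_of_discs hε hc hcε (fun N i s hs => outerDisc_differentiableAt hε N i hs)
    (outerDisc_boundary hε) (s₀ := 0) (by simp) _ one_pos
    (lam := fun _ => 1) (vN := fun _ => ![0, 1, 0]) (.of_forall fun N => by simp)
    tendsto_const_nhds (.of_forall fun N => ?_)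
  funext i
  fin_cases i <;> simp [outerDisc]

theorem completedGraph_subset_projHull (hε : ∀ j, 0 < ε j ∧ ε j < 1) (hsum : Summable ε)
    (hc : ∀ j, 0 < c j) (hcs : Summable c) (hcε : Summable fun j => c j / ε j) :
    completedGraph ε c ⊆ projHull (affine '' gamma0 ε c) := by
  rintro x (⟨⟨ζ, w⟩, hq, rfl⟩ | rfl)
  · obtain ⟨hζ, hw⟩ : ζ ∈ dom ε ∧ w = omega ε c ζ := mem_graphOmega.mp hq
    subst hw
    rcases lt_trichotomy ‖ζ‖ 1 with h | h | h
    · exact affine_mem_projHull_of_norm_lt hε hsum hc hcs hcε hζ h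
    · exact subset_projHull _ ⟨_, ⟨h, rfl⟩, rfl⟩
    · exact affine_mem_projHull_of_one_lt_norm hε hc hcε h
  · exact pointInf_mem_projHull hε hc hcε

/-! ### Polynomials that bound the hull -/

/-- The homogeneous polynomial `∏ (z - a_j t)`, over a finite set of indices. -/
noncomputable def poleProd (ε : ℕ → ℝ) (F : Finset ℕ) : MvPolynomial (Fin 3) ℂ :=
  ∏ j ∈ F, (MvPolynomial.X 1 - MvPolynomial.C (pole ε j) * MvPolynomial.X 0)

/-- The homogenization of the polynomial `∏_{j < N} (z - a_j) * (w - ω_N(z))`, where `ω_N` is the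
`N`-th partial sum of `ω`. -/
noncomputable def graphPoly (ε c : ℕ → ℝ) (N : ℕ) : MvPolynomial (Fin 3) ℂ :=
  MvPolynomial.X 2 * poleProd ε (Finset.range N)
    - MvPolynomial.C (omegaConst ε c) * (MvPolynomial.X 0 * poleProd ε (Finset.range N))
    - ∑ j ∈ Finset.range N, MvPolynomial.C (c j : ℂ) *
      (MvPolynomial.X 0 * (MvPolynomial.X 0 * poleProd ε ((Finset.range N).erase j)))

theorem poleProd_isHomogeneous (ε : ℕ → ℝ) (F : Finset ℕ) :
    (poleProd ε F).IsHomogeneous F.card := by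
  rw [Finset.card_eq_sum_ones]
  exact MvPolynomial.IsHomogeneous.prod _ _ _ fun j _ =>
    (MvPolynomial.isHomogeneous_X _ _).sub ((MvPolynomial.isHomogeneous_X _ _).C_mul _)

theorem graphPoly_isHomogeneous (ε c : ℕ → ℝ) (N : ℕ) :
    (graphPoly ε c N).IsHomogeneous (N + 1) := by
  have h1 : (poleProd ε (Finset.range N)).IsHomogeneous N := by
    simpa using poleProd_isHomogeneous ε (Finset.range N)
  have hX (i : Fin 3) := MvPolynomial.isHomogeneous_X ℂ i
  rw [add_comm]
  refine (((hX 2).mul h1).sub (((hX 0).mul h1).C_mul _)).sub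
    (MvPolynomial.IsHomogeneous.sum _ _ _ fun j hj => ?_)
  have h2 := poleProd_isHomogeneous ε ((Finset.range N).erase j)
  have h3 := (hX 0).mul ((hX 0).mul h2)
  rw [add_comm 1 (Finset.card _), Finset.card_erase_add_one hj, Finset.card_range] at h3
  exact h3.C_mul _

theorem eval_poleProd (ε : ℕ → ℝ) (F : Finset ℕ) (v : Fin 3 → ℂ) :
    MvPolynomial.eval v (poleProd ε F) = ∏ j ∈ F, (v 1 - pole ε j * v 0) := by
  simp [poleProd, map_prod]

theorem eval_graphPoly (ε c : ℕ → ℝ) (N : ℕ) (v : Fin 3 → ℂ) :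
    MvPolynomial.eval v (graphPoly ε c N)
      = v 2 * ∏ j ∈ Finset.range N, (v 1 - pole ε j * v 0)
        - omegaConst ε c * (v 0 * ∏ j ∈ Finset.range N, (v 1 - pole ε j * v 0))
        - ∑ j ∈ Finset.range N, c j * (v 0 * (v 0 *
          ∏ k ∈ (Finset.range N).erase j, (v 1 - pole ε k * v 0))) := by
  simp [graphPoly, eval_poleProd, map_sum]

theorem eval_graphPoly_of_ne_pole {ζ : ℂ} (hζ : ∀ j, ζ ≠ pole ε j) (w : ℂ) (N : ℕ) :
    MvPolynomial.eval ![1, ζ, w] (graphPoly ε c N)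
      = (∏ j ∈ Finset.range N, (ζ - pole ε j)) * (w - omegaPartial ε c N ζ) := by
  rw [eval_graphPoly, omegaPartial]
  simp only [Matrix.cons_val, mul_one, one_mul]
  rw [mul_sub, mul_add, Finset.mul_sum]
  have h : ∀ j ∈ Finset.range N, (∏ j ∈ Finset.range N, (ζ - pole ε j)) * (c j / (ζ - pole ε j))
      = c j * ∏ k ∈ (Finset.range N).erase j, (ζ - pole ε k) := fun j hj => by
    rw [← Finset.mul_prod_erase _ _ hj]
    have := sub_ne_zero.mpr (hζ j)
    field_simp
  rw [Finset.sum_congr rfl h]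
  ring

theorem eval_graphPoly_pole (w : ℂ) {k N : ℕ} (hk : k < N) :
    MvPolynomial.eval ![1, pole ε k, w] (graphPoly ε c N)
      = -(c k * ∏ j ∈ (Finset.range N).erase k, (pole ε k - pole ε j)) := by
  rw [eval_graphPoly]
  simp only [Matrix.cons_val, mul_one, one_mul]
  have hk := Finset.mem_range.mpr hk
  rw [Finset.prod_eq_zero hk (sub_self _), mul_zero, mul_zero, sub_zero, zero_sub,
    Finset.sum_eq_single_of_mem k hk]
  intro j _ hj
  rw [Finset.prod_eq_zero (Finset.mem_erase.mpr ⟨hj.symm, hk⟩) (sub_self _), mul_zero]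

theorem one_le_norm_vec (z w : ℂ) : 1 ≤ ‖(!₂[1, z, w] : C3)‖ := by
  simpa using PiLp.norm_apply_le (!₂[1, z, w] : C3) 0

/-- On `γ₀` the polynomial `graphPoly ε c N` is as small as the tail of `ω`. -/
theorem sectionNorm_graphPoly_le (hε : ∀ j, 0 < ε j ∧ ε j < 1) (hc : ∀ j, 0 < c j)
    (hcε : Summable fun j => c j / ε j) (N : ℕ) :
    ∀ y ∈ affine '' gamma0 ε c, sectionNorm (N + 1) (graphPoly ε c N) y
      ≤ 2 ^ N * ∑' j, c (j + N) / ε (j + N) := by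
  rintro _ ⟨⟨ζ, w⟩, ⟨hζ, hw⟩, rfl⟩
  simp only at hζ hw
  subst hw
  rw [affine, sectionNorm_mk (graphPoly_isHomogeneous ε c N)]
  refine (div_le_self (norm_nonneg _) (one_le_pow₀ (one_le_norm_vec _ _))).trans ?_
  have h1 : (fun i => (!₂[1, ζ, omega ε c ζ] : C3) i) = ![1, ζ, omega ε c ζ] := rfl
  rw [h1, eval_graphPoly_of_ne_pole (ne_pole_of_one_le hε hζ.ge), norm_mul]
  have h2 : ‖∏ j ∈ Finset.range N, (ζ - pole ε j)‖ ≤ 2 ^ N := by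
    rw [norm_prod]
    refine (Finset.prod_le_prod (g := fun _ => 2) (fun j _ => norm_nonneg _)
      fun j _ => ?_).trans_eq (by rw [Finset.prod_const, Finset.card_range])
    refine (norm_sub_le _ _).trans ?_
    rw [hζ, norm_pole hε]
    linarith [(hε j).1]
  have h3 := norm_omega_sub_omegaPartial_le hε hc hcε hζ.ge N
  gcongr

/-- A point at which the polynomials `graphPoly ε c N` decay at most as fast as
`r ^ N ∏_{j < N} ε_j` is not in the hull, if the tails of `ω` decay faster. -/
theorem not_mem_projHull (hε : ∀ j, 0 < ε j ∧ ε j < 1) (hc : ∀ j, 0 < c j)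
    (hcε : Summable fun j => c j / ε j)
    (htail : ∀ N, ∑' j, c (j + N) / ε (j + N) ≤ (∏ j ∈ Finset.range N, ε j) / N.factorial)
    {v : C3} (hv : v ≠ 0) {κ r : ℝ} (hκ : 0 < κ) (hr : 0 < r)
    (hlow : ∀ᶠ N in atTop, κ * (r ^ N * ∏ j ∈ Finset.range N, ε j)
      ≤ ‖MvPolynomial.eval (fun i => v i) (graphPoly ε c N)‖) :
    Projectivization.mk ℂ v hv ∉ projHull (affine '' gamma0 ε c) := by
  rintro ⟨C, hC, hP⟩
  have hvpos : 0 < ‖v‖ := norm_pos_iff.mpr hv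
  set X := C * ‖v‖ with hX
  have hXpos : 0 < X := by positivity
  have hlim : Tendsto (fun N : ℕ => X * ((2 * X / r) ^ N / N.factorial)) atTop (𝓝 (X * 0)) :=
    (FloorSemiring.tendsto_pow_div_factorial_atTop (2 * X / r)).const_mul X
  rw [mul_zero] at hlim
  refine absurd (ge_of_tendsto hlim (b := κ) ?_) (not_le.mpr hκ)
  filter_upwards [hlow] with N hN
  have h1 := hP (N + 1) _ (graphPoly_isHomogeneous ε c N) _ (sectionNorm_graphPoly_le hε hc hcε N)
  rw [sectionNorm_mk (graphPoly_isHomogeneous ε c N), div_le_iff₀ (by positivity)] at h1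
  have hprod : 0 < ∏ j ∈ Finset.range N, ε j := Finset.prod_pos fun j _ => (hε j).1
  have hfac : (0 : ℝ) < N.factorial := by positivity
  have h2 : κ * (r ^ N * ∏ j ∈ Finset.range N, ε j)
      ≤ X * ((2 * X / r) ^ N / N.factorial) * (r ^ N * ∏ j ∈ Finset.range N, ε j) := by
    calc κ * (r ^ N * ∏ j ∈ Finset.range N, ε j)
        ≤ C ^ (N + 1) * (2 ^ N * ∑' j, c (j + N) / ε (j + N)) * ‖v‖ ^ (N + 1) := hN.trans h1
      _ ≤ C ^ (N + 1) * (2 ^ N * ((∏ j ∈ Finset.range N, ε j) / N.factorial))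
            * ‖v‖ ^ (N + 1) := by
          gcongr
          exact htail N
      _ = X * ((2 * X / r) ^ N / N.factorial) * (r ^ N * ∏ j ∈ Finset.range N, ε j) := by
          rw [hX, div_pow]
          field_simp
          ring
  exact le_of_mul_le_mul_right h2 (by positivity)

/-- The distances from `ζ` to the poles are at least of the order of `ε_j`. They have a positive
lower bound for `ζ ≠ 1`, and are the `ε_j` themselves for `ζ = 1`. -/
theorem exists_mul_le_norm_sub_pole (hε : ∀ j, 0 < ε j ∧ ε j < 1) (hsum : Summable ε) (ζ : ℂ) :
    ∃ r, 0 < r ∧ ∀ j, ζ ≠ pole ε j → r * ε j ≤ ‖ζ - pole ε j‖ := by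
  by_cases h1 : ζ = 1
  · exact ⟨1, one_pos, fun j _ => by
      rw [one_mul]
      exact le_norm_sub_pole hε (by simp [h1]) j⟩
  · obtain ⟨M, hM, h⟩ := exists_inv_norm_sub_pole_le hsum h1
    refine ⟨M⁻¹, inv_pos.mpr hM, fun j hj => ?_⟩
    have h2 : M⁻¹ ≤ ‖ζ - pole ε j‖ := inv_le_of_inv_le₀ (norm_pos_iff.mpr (sub_ne_zero.mpr hj)) (h j)
    exact (mul_le_of_le_one_right (inv_pos.mpr hM).le (hε j).2.le).trans h2

theorem pow_mul_prod_le (hε : ∀ j, 0 < ε j ∧ ε j < 1) {ζ : ℂ} {r : ℝ} (hr : 0 < r)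
    (h : ∀ j, ζ ≠ pole ε j → r * ε j ≤ ‖ζ - pole ε j‖) (F : Finset ℕ)
    (hF : ∀ j ∈ F, ζ ≠ pole ε j) :
    ∏ j ∈ F, (r * ε j) ≤ ‖∏ j ∈ F, (ζ - pole ε j)‖ := by
  rw [norm_prod]
  exact Finset.prod_le_prod (fun j _ => (mul_pos hr (hε j).1).le) fun j hj => h j (hF j hj)

theorem affine_not_mem_projHull (hε : ∀ j, 0 < ε j ∧ ε j < 1) (hsum : Summable ε)
    (hc : ∀ j, 0 < c j) (hcε : Summable fun j => c j / ε j)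
    (htail : ∀ N, ∑' j, c (j + N) / ε (j + N) ≤ (∏ j ∈ Finset.range N, ε j) / N.factorial)
    {ζ w : ℂ} (hζ : ∀ j, ζ ≠ pole ε j) (hs : Summable fun j => (c j : ℂ) / (ζ - pole ε j))
    (hw : w ≠ omega ε c ζ) : affine (ζ, w) ∉ projHull (affine '' gamma0 ε c) := by
  obtain ⟨r, hr, h⟩ := exists_mul_le_norm_sub_pole hε hsum ζ
  have hpos : 0 < ‖w - omega ε c ζ‖ := norm_pos_iff.mpr (sub_ne_zero.mpr hw)
  refine not_mem_projHull hε hc hcε htail (affine_ne_zero _ _) (half_pos hpos) hr ?_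
  have hlim := ((tendsto_omegaPartial hs).const_sub w).norm
  filter_upwards [hlim.eventually (lt_mem_nhds (half_lt_self hpos))] with N hN
  have h1 := pow_mul_prod_le hε hr h (Finset.range N) fun j _ => hζ j
  rw [Finset.prod_mul_distrib, Finset.prod_const, Finset.card_range] at h1
  change _ ≤ ‖MvPolynomial.eval ![1, ζ, w] (graphPoly ε c N)‖
  rw [eval_graphPoly_of_ne_pole hζ, norm_mul, mul_comm]
  have : 0 ≤ r ^ N * ∏ j ∈ Finset.range N, ε j := by
    have := Finset.prod_nonneg fun j (_ : j ∈ Finset.range N) => (hε j).1.le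
    positivity
  exact mul_le_mul h1 hN.le (half_pos hpos).le (norm_nonneg _)

theorem affine_pole_not_mem_projHull (hε : ∀ j, 0 < ε j ∧ ε j < 1) (hinj : Function.Injective ε)
    (hsum : Summable ε) (hc : ∀ j, 0 < c j) (hcε : Summable fun j => c j / ε j)
    (htail : ∀ N, ∑' j, c (j + N) / ε (j + N) ≤ (∏ j ∈ Finset.range N, ε j) / N.factorial)
    (k : ℕ) (w : ℂ) : affine (pole ε k, w) ∉ projHull (affine '' gamma0 ε c) := by
  obtain ⟨r, hr, h⟩ := exists_mul_le_norm_sub_pole hε hsum (pole ε k)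
  have hrk : 0 < r * ε k := mul_pos hr (hε k).1
  refine not_mem_projHull hε hc hcε htail (affine_ne_zero _ _) (div_pos (hc k) hrk) hr ?_
  filter_upwards [eventually_gt_atTop k] with N hN
  have h1 := pow_mul_prod_le hε hr h ((Finset.range N).erase k) fun j hj hjk =>
    Finset.ne_of_mem_erase hj (pole_injective hinj hjk).symm
  change _ ≤ ‖MvPolynomial.eval ![1, pole ε k, w] (graphPoly ε c N)‖
  rw [eval_graphPoly_pole w hN, norm_neg, norm_mul, Complex.norm_real, Real.norm_eq_abs,
    abs_of_pos (hc k)]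
  have h2 : r ^ N * ∏ j ∈ Finset.range N, ε j
      = r * ε k * ∏ j ∈ (Finset.range N).erase k, (r * ε j) := by
    rw [Finset.mul_prod_erase (Finset.range N) (fun j => r * ε j) (Finset.mem_range.mpr hN),
      Finset.prod_mul_distrib, Finset.prod_const, Finset.card_range]
  rw [h2, ← mul_assoc, div_mul_cancel₀ _ hrk.ne']
  exact mul_le_mul_of_nonneg_left h1 (hc k).le

theorem not_mem_projHull_of_infinity (hε : ∀ j, 0 < ε j ∧ ε j < 1) (hc : ∀ j, 0 < c j)
    (hcε : Summable fun j => c j / ε j)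
    (htail : ∀ N, ∑' j, c (j + N) / ε (j + N) ≤ (∏ j ∈ Finset.range N, ε j) / N.factorial)
    {x : P2} (h0 : x.rep 0 = 0) (h1 : x.rep 1 ≠ 0) (h2 : x.rep 2 ≠ 0) :
    x ∉ projHull (affine '' gamma0 ε c) := by
  rw [← x.mk_rep]
  refine not_mem_projHull hε hc hcε htail x.rep_nonzero (norm_pos_iff.mpr h2)
    (norm_pos_iff.mpr h1) (.of_forall fun N => ?_)
  rw [eval_graphPoly]
  simp only [h0, mul_zero, zero_mul, sub_zero, Finset.sum_const_zero, Finset.prod_const,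
    Finset.card_range, norm_mul, norm_pow]
  have : ∏ j ∈ Finset.range N, ε j ≤ 1 :=
    Finset.prod_le_one (fun j _ => (hε j).1.le) fun j _ => (hε j).2.le
  gcongr
  exact mul_le_of_le_one_right (by positivity) this

/-- The projective hull of `γ₀`. -/
theorem projHull_eq (hε : ∀ j, 0 < ε j ∧ ε j < 1) (hinj : Function.Injective ε)
    (hsum : Summable ε) (hc : ∀ j, 0 < c j) (hcs : Summable c) (hcε : Summable fun j => c j / ε j)
    (htail : ∀ N, ∑' j, c (j + N) / ε (j + N) ≤ (∏ j ∈ Finset.range N, ε j) / N.factorial) :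
    projHull (affine '' gamma0 ε c) = completedGraph ε c ∪ {ell, affine (1, omega ε c 1)} := by
  have hone : (1 : ℝ) ≤ ‖(1 : ℂ)‖ := by simp
  apply Set.Subset.antisymm
  · intro x hx
    by_contra hnot
    rw [Set.mem_union, Set.mem_insert_iff, Set.mem_singleton_iff, not_or, not_or] at hnot
    obtain ⟨hW, hell, hp⟩ := hnot
    by_cases h0 : x ∈ chart 0
    · rw [mem_completedGraph_chart_zero h0] at hW
      rw [eq_affine h0] at hx hp
      by_cases hz : ∃ k, ratio 1 0 x = pole ε k
      · obtain ⟨k, hk⟩ := hz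
        rw [hk] at hx
        exact affine_pole_not_mem_projHull hε hinj hsum hc hcε htail k _ hx
      · push Not at hz
        by_cases h1 : ratio 1 0 x = 1
        · rw [h1] at hx hp
          exact affine_not_mem_projHull hε hsum hc hcε htail (ne_pole_of_one_le hε hone)
            (summable_of_one_le hε hc hcε hone) (fun h => hp (by rw [h])) hx
        · exact affine_not_mem_projHull hε hsum hc hcε htail hz (summable_cauchySum hsum hcs h1)
            (fun h => hW ⟨⟨h1, hz⟩, h⟩) hx
    · have h0 : x.rep 0 = 0 := not_not.mp h0
      exact not_mem_projHull_of_infinity hε hc hcε htail h0 (fun h1 => hell (eq_ell h0 h1))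
        (fun h2 => hW (Or.inr (eq_pointInf h0 h2))) hx
  · rintro x (hx | rfl | rfl)
    · exact completedGraph_subset_projHull hε hsum hc hcs hcε hx
    · exact ell_mem_projHull hε hinj hsum hc hcε
    · exact subset_projHull _ ⟨_, ⟨norm_one, rfl⟩, rfl⟩

theorem closure_projHull_eq (hε : ∀ j, 0 < ε j ∧ ε j < 1) (hinj : Function.Injective ε)
    (hsum : Summable ε) (hc : ∀ j, 0 < c j) (hcs : Summable c) (hcε : Summable fun j => c j / ε j)
    (htail : ∀ N, ∑' j, c (j + N) / ε (j + N) ≤ (∏ j ∈ Finset.range N, ε j) / N.factorial) :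
    closure (projHull (affine '' gamma0 ε c)) = completedGraph ε c ∪ lineL := by
  rw [projHull_eq hε hinj hsum hc hcs hcε htail]
  apply Set.Subset.antisymm
  · refine closure_minimal (Set.union_subset_union_right _ ?_)
      (isClosed_completedGraph_union hε hinj hsum hc hcs hcε)
    rintro x (rfl | rfl)
    · exact ell_mem_lineL
    · exact (affine_mem_lineL _).mpr rfl
  · refine Set.union_subset (Set.subset_union_left.trans subset_closure) ?_
    exact (lineL_subset_closure hε hinj hsum hc hcs).trans
      (closure_mono (Set.subset_union_left.trans Set.subset_union_left))

/-! ### Real analyticity of `γ₀` -/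

theorem isRealAnalyticCurveAt_gamma0 (hε : ∀ j, 0 < ε j ∧ ε j < 1) (hsum : Summable ε)
    (hcs : Summable c) {ζ : ℂ} (hζ : ‖ζ‖ = 1) (h1 : ζ ≠ 1) :
    IsRealAnalyticCurveAt (gamma0 ε c) (ζ, omega ε c ζ) := by
  have h0 : ζ ≠ 0 := norm_ne_zero_iff.mp (by rw [hζ]; exact one_ne_zero)
  set e : ℝ → ℂ := fun s => ζ * Complex.exp (s * Complex.I) with he
  have he0 : e 0 = ζ := by simp [he]
  have heC : AnalyticAt ℂ (fun s : ℂ => ζ * Complex.exp (s * Complex.I)) ((0 : ℝ) : ℂ) := by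
    fun_prop
  have hean : AnalyticAt ℝ e 0 :=
    (heC.restrictScalars (𝕜 := ℝ)).fun_comp (Complex.ofRealCLM.analyticAt 0)
  have hnorm (s : ℝ) : ‖e s‖ = 1 := by
    simp only [he, norm_mul, hζ, Complex.norm_exp_ofReal_mul_I, one_mul]
  have hω : AnalyticAt ℝ (fun s => omega ε c (e s)) 0 := by
    have h2 := (omega_analyticAt hsum hcs (mem_dom_of_one_le hε hζ.ge h1)).restrictScalars (𝕜 := ℝ)
    rw [← he0] at h2
    exact h2.fun_comp hean
  have hφan : AnalyticAt ℝ (fun s => (e s, omega ε c (e s))) 0 := hean.prod hω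
  have hφ0 : (e 0, omega ε c (e 0)) = (ζ, omega ε c ζ) := by rw [he0]
  refine ⟨fun s => (e s, omega ε c (e s)), hφan, fun hd => ?_, hφ0, ?_⟩
  · have h2 : HasDerivAt e (ζ * Complex.I) 0 := by
      have h3 : HasDerivAt (fun s : ℂ => ζ * Complex.exp (s * Complex.I))
          (ζ * (Complex.exp (((0 : ℝ) : ℂ) * Complex.I) * (1 * Complex.I))) ((0 : ℝ) : ℂ) :=
        (((hasDerivAt_id _).mul_const Complex.I).cexp).const_mul ζ
      simpa using! h3.comp_ofReal
    have h4 := (h2.prodMk hω.differentiableAt.hasDerivAt).deriv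
    rw [hd] at h4
    exact mul_ne_zero h0 Complex.I_ne_zero (congrArg Prod.fst h4).symm
  · have h := map_nhds_eq_nhdsWithin (A := gamma0 ε c) (s := (0 : ℝ))
      (φ := fun s => (e s, omega ε c (e s))) (ρ := fun q => Complex.arg (q.1 / ζ))
      hφan.continuousAt (.of_forall fun s => ⟨hnorm s, rfl⟩) ?_ ?_ ?_
    · simpa only [hφ0] using! h
    · refine ContinuousAt.continuousWithinAt ?_
      refine ContinuousAt.comp (g := Complex.arg) (f := fun q : ℂ × ℂ => q.1 / ζ) ?_ (by fun_prop)
      rw [he0, div_self h0]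
      exact Complex.continuousAt_arg Complex.one_mem_slitPlane
    · simp [he0, h0]
    · filter_upwards [self_mem_nhdsWithin] with q hq
      have h2 : e (Complex.arg (q.1 / ζ)) = q.1 := by
        have h3 := Complex.norm_mul_exp_arg_mul_I (q.1 / ζ)
        rw [norm_div, hq.1, hζ, div_one, Complex.ofReal_one, one_mul] at h3
        simp only [he, h3]
        field_simp
      rw [h2, ← hq.2]

/-- The complexification of a real power series. -/
theorem exists_holomorphic_extension {φ : ℝ → ℂ} (hφ : AnalyticAt ℝ φ 0) :
    ∃ F : ℂ → ℂ, AnalyticAt ℂ F 0 ∧ ∀ᶠ s : ℝ in 𝓝 0, F s = φ s := by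
  obtain ⟨p, hp⟩ := hφ
  have hs := hasFPowerSeriesAt_iff.mp hp
  simp only [zero_add] at hs
  obtain ⟨R, hR, hball⟩ := Metric.eventually_nhds_iff.mp hs
  set r := R / 2 with hr
  have hr0 : 0 < r := half_pos hR
  have hsr := hball (y := r) (by
    rw [dist_zero_right, Real.norm_eq_abs, abs_of_pos hr0]
    exact half_lt_self hR)
  obtain ⟨M, hM⟩ := hsr.summable.tendsto_atTop_zero.norm.bddAbove_range
  set F : ℂ → ℂ := fun z => ∑' n, z ^ n • p.coeff n with hF
  refine ⟨F, ⟨FormalMultilinearSeries.ofScalars ℂ p.coeff, hasFPowerSeriesAt_iff.mpr ?_⟩, ?_⟩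
  · simp only [zero_add, FormalMultilinearSeries.coeff_ofScalars]
    filter_upwards [Metric.ball_mem_nhds (0 : ℂ) hr0] with z hz
    rw [mem_ball_zero_iff] at hz
    refine Summable.hasSum (Summable.of_norm_bounded (g := fun n => M * (‖z‖ / r) ^ n) ?_ fun n => ?_)
    · exact (summable_geometric_of_lt_one (by positivity) ((div_lt_one hr0).mpr hz)).mul_left M
    · have h1 : ‖r ^ n • p.coeff n‖ ≤ M := hM ⟨n, rfl⟩
      rw [norm_smul, norm_pow, Real.norm_eq_abs, abs_of_pos hr0] at h1
      rw [norm_smul, norm_pow, div_pow]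
      calc ‖z‖ ^ n * ‖p.coeff n‖ = r ^ n * ‖p.coeff n‖ * (‖z‖ ^ n / r ^ n) := by field_simp
        _ ≤ M * (‖z‖ ^ n / r ^ n) := by gcongr
  · filter_upwards [hs] with s h1
    rw [← h1.tsum_eq, hF]
    refine tsum_congr fun n => ?_
    rw [smul_eq_mul, Complex.real_smul, Complex.ofReal_pow]

theorem mem_dom_of_im_ne_zero {ζ : ℂ} (h : ζ.im ≠ 0) : ζ ∈ dom ε :=
  ⟨fun h1 => h (by rw [h1, Complex.one_im]), fun j h1 => h (by rw [h1, pole, Complex.ofReal_im])⟩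

/-- The restriction of `ω` to the circle does not extend holomorphically to a neighbourhood of `1`:
the extension would agree with `ω` on a half disc in the upper half plane, whose boundary contains
poles. -/
theorem not_eventually_eq_omega (hε : ∀ j, 0 < ε j ∧ ε j < 1) (hinj : Function.Injective ε)
    (hsum : Summable ε) (hc : ∀ j, 0 < c j) (hcs : Summable c) {g : ℂ → ℂ}
    (hg : AnalyticAt ℂ g 1) : ¬ ∀ᶠ ζ in 𝓝[Metric.sphere 0 1] (1 : ℂ), g ζ = omega ε c ζ := by
  intro hgω
  rw [eventually_nhdsWithin_iff] at hgω
  obtain ⟨r, hr, hball⟩ := Metric.eventually_nhds_iff_ball.mp (hg.eventually_analyticAt.and hgω)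
  set V : Set ℂ := Metric.ball 1 r ∩ {ζ | 0 < ζ.im} with hV
  have hVconv : Convex ℝ V := (convex_ball 1 r).inter (convex_halfSpace_im_gt 0)
  have hω : AnalyticOnNhd ℂ (omega ε c) V := fun ζ hζ =>
    omega_analyticAt hsum hcs (mem_dom_of_im_ne_zero (ne_of_gt hζ.2))
  have hgV : AnalyticOnNhd ℂ g V := fun ζ hζ => (hball ζ hζ.1).1
  set e : ℝ → ℂ := fun θ => Complex.exp (θ * Complex.I) with he
  have hecont : Continuous e := by fun_prop
  have hnorm (θ : ℝ) : e θ ∈ Metric.sphere (0 : ℂ) 1 := by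
    rw [mem_sphere_zero_iff_norm]
    exact Complex.norm_exp_ofReal_mul_I θ
  obtain ⟨θ₁, hθball, hθim⟩ : ∃ θ, e θ ∈ Metric.ball 1 r ∧ 0 < (e θ).im := by
    have h1 : ∀ᶠ θ in 𝓝[>] (0 : ℝ), e θ ∈ Metric.ball 1 r := by
      have h2 : Tendsto e (𝓝 0) (𝓝 1) := hecont.tendsto' _ _ (by simp [he])
      exact (h2.mono_left nhdsWithin_le_nhds).eventually (Metric.ball_mem_nhds 1 hr)
    have h3 : ∀ᶠ θ in 𝓝[>] (0 : ℝ), θ < Real.pi :=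
      mem_nhdsWithin_of_mem_nhds (gt_mem_nhds Real.pi_pos)
    obtain ⟨θ, h4, h5, h6⟩ := (h1.and (h3.and self_mem_nhdsWithin)).exists
    refine ⟨θ, h4, ?_⟩
    simp only [he, Complex.exp_ofReal_mul_I_im]
    exact Real.sin_pos_of_pos_of_lt_pi h6 h5
  have hder : HasDerivAt e (e θ₁ * Complex.I) θ₁ := by
    have h1 : HasDerivAt (fun s : ℂ => Complex.exp (s * Complex.I))
        (Complex.exp ((θ₁ : ℂ) * Complex.I) * (1 * Complex.I)) (θ₁ : ℂ) :=
      ((hasDerivAt_id _).mul_const Complex.I).cexp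
    simpa [he] using! h1.comp_ofReal
  have hne : Tendsto e (𝓝[≠] θ₁) (𝓝[≠] e θ₁) :=
    hder.tendsto_nhdsNE (mul_ne_zero (Complex.exp_ne_zero _) Complex.I_ne_zero)
  have hfreq : ∃ᶠ ζ in 𝓝[≠] e θ₁, g ζ = omega ε c ζ := by
    refine hne.frequently (Eventually.frequently ?_)
    filter_upwards [mem_nhdsWithin_of_mem_nhds
      (hecont.continuousAt.preimage_mem_nhds (Metric.isOpen_ball.mem_nhds hθball))] with θ h1
    exact (hball _ h1).2 (hnorm θ)
  have heq : Set.EqOn g (omega ε c) V :=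
    hgV.eqOn_of_preconnected_of_frequently_eq hω hVconv.isPreconnected ⟨hθball, hθim⟩ hfreq
  obtain ⟨k, hk⟩ := ((tendsto_pole hsum).eventually (Metric.ball_mem_nhds 1 hr)).exists
  have hvert : Tendsto (fun s : ℝ => pole ε k + s * Complex.I) (𝓝[>] 0) (𝓝 (pole ε k)) :=
    (Continuous.tendsto' (by fun_prop) _ _ (by simp)).mono_left nhdsWithin_le_nhds
  have hvert' : Tendsto (fun s : ℝ => pole ε k + s * Complex.I) (𝓝[>] 0) (𝓝[≠] pole ε k) := by
    refine tendsto_nhdsWithin_iff.mpr ⟨hvert, ?_⟩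
    filter_upwards [self_mem_nhdsWithin] with s hs
    simpa using ne_of_gt hs
  have hinf := (tendsto_norm_omega_pole hε hinj hsum hcs (hc k).ne').comp hvert'
  have hfin := (hball _ hk).1.continuousAt.norm.tendsto.comp hvert
  refine not_tendsto_nhds_of_tendsto_atTop hinf _ (hfin.congr' ?_)
  filter_upwards [hvert.eventually (Metric.isOpen_ball.mem_nhds hk), self_mem_nhdsWithin]
    with s h1 h2
  have h3 : 0 < (pole ε k + s * Complex.I).im := by simpa [pole] using h2
  simp only [Function.comp]
  rw [heq ⟨h1, h3⟩]

/-- At `(1, ω(1))` the curve is not real analytic. As `ω` is Lipschitz at `1`, the first component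
of an analytic parametrization would have non-zero derivative; inverting its complexification would
extend `ω` holomorphically from the circle. -/
theorem not_isRealAnalyticCurveAt_one (hε : ∀ j, 0 < ε j ∧ ε j < 1) (hinj : Function.Injective ε)
    (hsum : Summable ε) (hc : ∀ j, 0 < c j) (hcs : Summable c) (hcε : Summable fun j => c j / ε j)
    (hcε2 : Summable fun j => c j / ε j ^ 2) :
    ¬ IsRealAnalyticCurveAt (gamma0 ε c) (1, omega ε c 1) := by
  rintro ⟨φ, hφ, hd, hφ0, hmap⟩
  have hγ : ∀ᶠ s in 𝓝 0, φ s ∈ gamma0 ε c := by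
    have h1 : gamma0 ε c ∈ map φ (𝓝 0) := hmap ▸ self_mem_nhdsWithin
    exact h1
  have hφ1 : AnalyticAt ℝ (fun s => (φ s).1) 0 := analyticAt_fst.fun_comp hφ
  have hφ2 : AnalyticAt ℝ (fun s => (φ s).2) 0 := analyticAt_snd.fun_comp hφ
  have hd1 := hφ1.differentiableAt.hasDerivAt
  have hd2 := hφ2.differentiableAt.hasDerivAt
  have hne : deriv (fun s => (φ s).1) 0 ≠ 0 := by
    intro h1
    rw [h1] at hd1
    have h2 : HasDerivAt (fun s => (φ s).2) 0 0 := by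
      rw [hasDerivAt_iff_isLittleO] at hd1 ⊢
      simp only [smul_zero, sub_zero] at hd1 ⊢
      refine Asymptotics.IsBigO.trans_isLittleO ?_ hd1
      refine Asymptotics.IsBigO.of_bound (∑' j, c j / ε j ^ 2) ?_
      filter_upwards [hγ] with s hs
      rw [hφ0, hs.2]
      exact norm_omega_sub_omega_one_le hε hc hcε hcε2 hs.1.ge
    exact hd (hd1.prodMk h2).deriv
  obtain ⟨F₁, hF₁, hF₁φ⟩ := exists_holomorphic_extension hφ1
  obtain ⟨F₂, hF₂, hF₂φ⟩ := exists_holomorphic_extension hφ2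
  have hF₁0 : F₁ 0 = 1 := by
    have := hF₁φ.self_of_nhds
    rwa [Complex.ofReal_zero, hφ0] at this
  have hF₁d : deriv F₁ 0 ≠ 0 := by
    have h1 : HasDerivAt F₁ (deriv F₁ 0) ((0 : ℝ) : ℂ) := by
      rw [Complex.ofReal_zero]
      exact hF₁.differentiableAt.hasDerivAt
    have h2 := h1.comp_ofReal.congr_of_eventuallyEq (hF₁φ.mono fun s hs => hs.symm)
    rwa [hd1.unique h2] at hne
  have hstrict : HasStrictDerivAt F₁ (deriv F₁ 0) 0 := hF₁.hasStrictDerivAt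
  have hleft := hstrict.eventually_left_inverse hF₁d
  have hinv := hF₁.analyticAt_localInverse hF₁d
  set G := hstrict.localInverse F₁ (deriv F₁ 0) 0 hF₁d with hG
  have hG0 : G 1 = 0 := by
    have := hleft.self_of_nhds
    rwa [hF₁0] at this
  rw [hF₁0] at hinv
  have hg : AnalyticAt ℂ (fun ζ => F₂ (G ζ)) 1 :=
    AnalyticAt.fun_comp (by rw [hG0]; exact hF₂) hinv
  refine not_eventually_eq_omega hε hinj hsum hc hcs hg ?_
  have hreal : Tendsto (fun s : ℝ => (s : ℂ)) (𝓝 0) (𝓝 0) :=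
    Complex.continuous_ofReal.tendsto' _ _ Complex.ofReal_zero
  have hmem : ∀ᶠ q in 𝓝[gamma0 ε c] (1, omega ε c 1), F₂ (G q.1) = omega ε c q.1 := by
    rw [← hmap, eventually_map]
    filter_upwards [hγ, hF₁φ, hF₂φ, hreal.eventually hleft] with s h1 h2 h3 h4
    rw [← h2, h4, h3, h2, h1.2]
  have hgraph : Tendsto (fun ζ => (ζ, omega ε c ζ)) (𝓝[Metric.sphere 0 1] (1 : ℂ))
      (𝓝[gamma0 ε c] (1, omega ε c 1)) := by
    refine tendsto_nhdsWithin_iff.mpr ⟨?_, ?_⟩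
    · refine Tendsto.prodMk_nhds (tendsto_id.mono_left nhdsWithin_le_nhds) ?_
      exact ((continuousOn_omega hε hc hcε).mono fun z hz =>
        (mem_sphere_zero_iff_norm.mp hz).ge) 1 (by simp)
    · filter_upwards [self_mem_nhdsWithin] with ζ hζ
      exact ⟨mem_sphere_zero_iff_norm.mp hζ, rfl⟩
  exact hgraph.eventually hmem

/-! ### Transcendence of `ω` -/

open Polynomial Polynomial.Bivariate in
/-- `ω` satisfies no algebraic equation: the leading coefficient would vanish at all poles. -/
theorem eq_zero_of_evalEval_omega (hε : ∀ j, 0 < ε j ∧ ε j < 1) (hinj : Function.Injective ε)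
    (hsum : Summable ε) (hc : ∀ j, 0 < c j) (hcs : Summable c) {Q : ℂ[X][Y]}
    (hQ : ∀ ζ ∈ dom ε, Q.evalEval ζ (omega ε c ζ) = 0) : Q = 0 := by
  rw [← leadingCoeff_eq_zero]
  refine eq_zero_of_infinite_isRoot _ ((Set.infinite_range_of_injective
    (pole_injective hinj)).mono ?_)
  rintro _ ⟨k, rfl⟩
  set n := Q.natDegree with hn
  have hω := tendsto_norm_omega_pole hε hinj hsum hcs (hc k).ne'
  have hinv : Tendsto (fun ζ => (omega ε c ζ)⁻¹) (𝓝[≠] pole ε k) (𝓝 0) :=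
    tendsto_inv₀_cobounded.comp (tendsto_norm_atTop_iff_cobounded.mp hω)
  have hcoeff (i : ℕ) : Tendsto (fun ζ => (Q.coeff i).eval ζ) (𝓝[≠] pole ε k)
      (𝓝 ((Q.coeff i).eval (pole ε k))) :=
    (Q.coeff i).continuous.continuousAt.tendsto.mono_left nhdsWithin_le_nhds
  have hlow : Tendsto (fun ζ => -∑ i ∈ Finset.range n,
      (Q.coeff i).eval ζ * (omega ε c ζ)⁻¹ ^ (n - i)) (𝓝[≠] pole ε k) (𝓝 (-0)) := by
    refine Tendsto.neg ?_
    rw [← Finset.sum_const_zero (ι := ℕ) (s := Finset.range n)]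
    refine tendsto_finsetSum _ fun i hi => ?_
    have h1 := (hcoeff i).mul (hinv.pow (n - i))
    rwa [zero_pow (Nat.sub_ne_zero_of_lt (Finset.mem_range.mp hi)), mul_zero] at h1
  rw [neg_zero] at hlow
  have : (𝓝[≠] pole ε k).NeBot := inferInstance
  refine tendsto_nhds_unique (hcoeff n) (hlow.congr' ?_)
  filter_upwards [eventually_mem_dom_punctured hε hinj hsum k, hω.eventually_gt_atTop 0]
    with ζ h1 h2
  have h3 : omega ε c ζ ≠ 0 := norm_pos_iff.mp h2
  have h4 := hQ ζ h1
  rw [evalEval, eval_eq_sum_range (p := Q), eval_finsetSum, Finset.sum_range_succ] at h4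
  simp only [eval_mul, eval_pow, eval_C] at h4
  have h5 : ∀ i ∈ Finset.range n, (Q.coeff i).eval ζ * (omega ε c ζ)⁻¹ ^ (n - i)
      = (Q.coeff i).eval ζ * omega ε c ζ ^ i * (omega ε c ζ ^ n)⁻¹ := fun i hi => by
    rw [inv_pow, pow_sub₀ _ h3 (Finset.mem_range.mp hi).le, mul_inv, inv_inv]
    ring
  rw [Finset.sum_congr rfl h5, ← Finset.sum_mul, eq_neg_of_add_eq_zero_left h4, neg_mul, neg_neg,
    mul_assoc, mul_inv_cancel₀ (pow_ne_zero _ h3), mul_one]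

open Polynomial Polynomial.Bivariate in
theorem exists_bivariate (P : MvPolynomial (Fin 3) ℂ) :
    ∃ Q : ℂ[X][Y], ∀ z w : ℂ, Q.evalEval z w = MvPolynomial.eval ![1, z, w] P := by
  induction P using MvPolynomial.induction_on with
  | C a => exact ⟨CC a, fun z w => by simp⟩
  | add p q hp hq =>
    obtain ⟨A, hA⟩ := hp
    obtain ⟨B, hB⟩ := hq
    exact ⟨A + B, fun z w => by simp [hA, hB]⟩
  | mul_X p i hp =>
    obtain ⟨A, hA⟩ := hp
    refine ⟨A * ![1, C X, Y] i, fun z w => ?_⟩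
    rw [evalEval_mul, hA, map_mul, MvPolynomial.eval_X]
    congr 1
    fin_cases i
    · simp
    · simp [evalEval_C]
    · simp

theorem eval_rep_affine_eq_zero_iff {d : ℕ} {P : MvPolynomial (Fin 3) ℂ} (hP : P.IsHomogeneous d)
    (q : ℂ × ℂ) : MvPolynomial.eval (fun i => (affine q).rep i) P = 0 ↔
      MvPolynomial.eval ![1, q.1, q.2] P = 0 := by
  obtain ⟨a, ha, har⟩ := exists_rep_mk _ (affine_ne_zero q.1 q.2)
  have h1 : (fun i => (affine q).rep i) = fun i => a * (!₂[1, q.1, q.2] : C3) i := funext har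
  rw [h1, eval_homogeneous hP a fun i => (!₂[1, q.1, q.2] : C3) i, mul_eq_zero,
    or_iff_right (pow_ne_zero d ha)]

theorem not_isAlgebraicIn_completedGraph (hε : ∀ j, 0 < ε j ∧ ε j < 1)
    (hinj : Function.Injective ε) (hsum : Summable ε) (hc : ∀ j, 0 < c j) (hcs : Summable c) :
    ¬ IsAlgebraicIn (completedGraph ε c) lineLᶜ := by
  rintro ⟨S, hS, hA⟩
  have hdom : (2 : ℂ) ∈ dom ε := mem_dom_of_one_le hε (by simp) (by norm_num)
  have hx : affine (2, omega ε c 2 + 1) ∉ completedGraph ε c := by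
    rw [affine_mem_completedGraph, mem_graphOmega]
    simp
  rw [hA, Set.mem_ofPred_eq, not_and] at hx
  refine hx (fun h => hdom.1 ((affine_mem_lineL _).mp h)) fun P hP => ?_
  obtain ⟨d, hd⟩ := hS P hP
  rw [eval_rep_affine_eq_zero_iff hd]
  obtain ⟨Q, hQ⟩ := exists_bivariate P
  have hvan : ∀ ζ ∈ dom ε, Q.evalEval ζ (omega ε c ζ) = 0 := fun ζ hζ => by
    have h1 : affine (ζ, omega ε c ζ) ∈ completedGraph ε c :=
      affine_mem_completedGraph.mpr (mem_graphOmega.mpr ⟨hζ, rfl⟩)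
    rw [hA, Set.mem_ofPred_eq] at h1
    have h2 := (eval_rep_affine_eq_zero_iff hd (ζ, omega ε c ζ)).mp (h1.2 P hP)
    exact (hQ _ _).trans h2
  have hQ0 : Q = 0 := eq_zero_of_evalEval_omega hε hinj hsum hc hcs hvan
  rw [← hQ, hQ0, Polynomial.evalEval_zero]

/-! ### The choice of the decay -/

/-- The rate `∏_{i < j} ε_i / j!` at which the tails of `ω` are made to decay. -/
noncomputable def rate (ε : ℕ → ℝ) (j : ℕ) : ℝ := (∏ i ∈ Finset.range j, ε i) / j.factorial

theorem rate_pos (hε : ∀ j, 0 < ε j ∧ ε j < 1) (j : ℕ) : 0 < rate ε j :=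
  div_pos (Finset.prod_pos fun i _ => (hε i).1) (by positivity)

theorem rate_antitone (hε : ∀ j, 0 < ε j ∧ ε j < 1) : Antitone (rate ε) := by
  refine antitone_nat_of_succ_le fun j => ?_
  have h1 : 0 < ∏ i ∈ Finset.range j, ε i := Finset.prod_pos fun i _ => (hε i).1
  rw [rate, rate, Finset.prod_range_succ]
  have h2 : (j.factorial : ℝ) ≤ (j + 1).factorial := by
    exact_mod_cast Nat.factorial_le (Nat.le_succ j)
  exact div_le_div₀ h1.le (mul_le_of_le_one_right h1.le (hε j).2.le) (by positivity) h2

end ProjHull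

theorem theorem3 (ε : ℕ → ℝ) (hε : ∀ j, 0 < ε j ∧ ε j < 1) (hinj : Function.Injective ε)
    (hsum : Summable ε) :
    ∃ δ : ℕ → ℝ, (∀ j, 0 < δ j) ∧
      ∀ c : ℕ → ℝ, (∀ j, 0 < c j ∧ c j ≤ δ j) →
        -- the series converge, and the graph of `ω` over the circle is a simple closed curve
        Summable (fun j => c j / ε j) ∧
        ContinuousOn (ProjHull.omega ε c) (Metric.sphere 0 1) ∧
        -- `γ₀` is real analytic except at one point
        (∀ q ∈ ProjHull.gamma0 ε c,
          ProjHull.IsRealAnalyticCurveAt (ProjHull.gamma0 ε c) q ↔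
            q ≠ (1, ProjHull.omega ε c 1)) ∧
        -- `W` is a one-dimensional analytic, non-algebraic subvariety of `P² ∖ L`
        ProjHull.IsAnalyticSubvariety (ProjHull.W ε c) ProjHull.lineLᶜ ∧
        ProjHull.HasPureDimensionOne (ProjHull.W ε c) ∧
        ¬ ProjHull.IsAlgebraicIn (ProjHull.W ε c) ProjHull.lineLᶜ ∧
        -- the projective hull of `γ₀` and its closure
        ProjHull.projHull (ProjHull.affine '' ProjHull.gamma0 ε c) =
          ProjHull.W ε c ∪ {ProjHull.ell, ProjHull.affine (1, ProjHull.omega ε c 1)} ∧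
        closure (ProjHull.projHull (ProjHull.affine '' ProjHull.gamma0 ε c)) =
          ProjHull.W ε c ∪ ProjHull.lineL := by
  open ProjHull in
  refine ⟨fun j => ε j ^ 2 * (rate ε j / 2 / 2 ^ j), fun j => mul_pos (pow_pos (hε j).1 2)
    (by have := rate_pos hε j; positivity), fun c hcδ => ?_⟩
  have hc : ∀ j, 0 < c j := fun j => (hcδ j).1
  have hle : ∀ j, c j / ε j ^ 2 ≤ rate ε j / 2 / 2 ^ j := fun j => by
    rw [div_le_iff₀' (pow_pos (hε j).1 2)]
    exact (hcδ j).2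
  have hle1 : ∀ j, c j / ε j ≤ c j / ε j ^ 2 := fun j =>
    div_le_div_of_nonneg_left (hc j).le (pow_pos (hε j).1 2)
      (pow_le_of_le_one (hε j).1.le (hε j).2.le two_ne_zero)
  have hle0 : ∀ j, c j ≤ c j / ε j := fun j =>
    (le_div_iff₀ (hε j).1).mpr (mul_le_of_le_one_right (hc j).le (hε j).2.le)
  have hbound : ∀ N j, c (j + N) / ε (j + N) ^ 2 ≤ rate ε N / 2 / 2 ^ j := fun N j => by
    refine (hle (j + N)).trans ?_
    have h1 := rate_antitone hε (Nat.le_add_left N j)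
    have h2 : (2 : ℝ) ^ j ≤ 2 ^ (j + N) :=
      pow_le_pow_right₀ one_le_two (Nat.le_add_right j N)
    have h3 := rate_pos hε N
    gcongr
  have hcε2 : Summable fun j => c j / ε j ^ 2 :=
    Summable.of_nonneg_of_le (fun j => div_nonneg (hc j).le (sq_nonneg _)) (hbound 0)
      (hasSum_geometric_two' (rate ε 0)).summable
  have hcε : Summable fun j => c j / ε j :=
    Summable.of_nonneg_of_le (fun j => div_nonneg (hc j).le (hε j).1.le) hle1 hcε2
  have hcs : Summable c := Summable.of_nonneg_of_le (fun j => (hc j).le) hle0 hcε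
  have htail : ∀ N, ∑' j, c (j + N) / ε (j + N) ≤
      (∏ j ∈ Finset.range N, ε j) / N.factorial := fun N => by
    rw [← rate, ← (hasSum_geometric_two' (rate ε N)).tsum_eq]
    exact Summable.tsum_le_tsum (fun j => (hle1 (j + N)).trans (hbound N j))
      ((summable_nat_add_iff N).mpr hcε) (hasSum_geometric_two' (rate ε N)).summable
  rw [W_eq_completedGraph hε hinj hsum hc hcs hcε]
  refine ⟨hcε, (continuousOn_omega hε hc hcε).mono fun z hz => (mem_sphere_zero_iff_norm.mp hz).ge,
    ?_, isAnalyticSubvariety_completedGraph hε hinj hsum hc hcs hcε,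
    hasPureDimensionOne_completedGraph hε hc hsum hcs hcε,
    not_isAlgebraicIn_completedGraph hε hinj hsum hc hcs,
    projHull_eq hε hinj hsum hc hcs hcε htail, closure_projHull_eq hε hinj hsum hc hcs hcε htail⟩
  rintro ⟨ζ, w⟩ ⟨hζ, hw⟩
  simp only at hζ hw
  subst hw
  constructor
  · intro h h1
    rw [h1] at h
    exact not_isRealAnalyticCurveAt_one hε hinj hsum hc hcs hcε hcε2 h
  · exact fun h => isRealAnalyticCurveAt_gamma0 hε hsum hcs hζ fun h1 => h (by rw [h1])
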